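/- Let $\mathcal A$ be a unital $C^*$-algebra with a state $\varphi$, let $I$ be an index set with at least two elements, and for each $i\in I$ let $A_l^{(i)},A_r^{(i)}\subseteq\mathcal A$ be unital $C^*$-subalgebras (containing the unit of $\mathcal A$), called the left and right face of the $i$-th pair. Let $C_i=C^*(A_l^{(i)},A_r^{(i)})\subseteq\mathcal A$ be the $C^*$-algebra they generate and let $\varphi_i=\varphi|_{C_i}$. Assume that $C_i\neq\mathbb C 1$ and that $\varphi_i$ is faithful on $C_i$ for every $i\in I$ (a state $\psi$ is faithful if $\psi(x^*x)=0$ implies $x=0$). Let $(\pi_i,H_i,\xi_i)$ be the GNS construction of $(C_i,\varphi_i)$, let $\mathring H_i=H_i\ominus\mathbb C\xi_i$, and let $$H=\mathbb C\xi\oplus\bigoplus_{n\ge 1,\ i_1\ne i_2\ne\cdots\ne i_n}\mathring H_{i_1}\otimes\cdots\otimes\mathring H_{i_n}$$ be the free product Hilbert space with unit vector $\xi$, where $i_1\neq i_2\neq\cdots\neq i_n$ means that consecutive indices are distinct. Let $H(l,i)$ (respectively $H(r,i)$) be the closed subspace of $H$ given by $\mathbb C\xi$ and the summands with $i_1\ne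 i$ (respectively $i_n\neq i$). Let $V_i:H_i\otimes H(l,i)\to H$ and $W_i:H(r,i)\otimes H_i\to H$ be the unitaries given by concatenation of tensors, with $\xi_i$ and $\xi$ absorbed, and for $T\in B(H_i)$ put $\lambda_i(T)=V_i(T\otimes 1)V_i^*$ and $\rho_i(T)=W_i(1\otimes T)W_i^*$. The reduced bi-free product is the $C^*$-subalgebra of $B(H)$ generated by $\lambda_i(\pi_i(A_l^{(i)}))$ and $\rho_i(\pi_i(A_r^{(i)}))$, $i\in I$, and the bi-free product state on it is $T\mapsto\langle T\xi,\xi\rangle$. If the bi-free product state is faithful on the reduced bi-free product, then for every $i\in I$ the faces $A_l^{(i)}$ and $A_r^{(i)}$ commute, and there is a $*$-isomorphism $$C^*(A_l^{(i)},A_r^{(i)})\;\cong\;A_l^{(i)}\otimes_{\min}A_r^{(i)}$$ sending $ab$ to $a\otimes b$ for all $a\in A_l^{(i)}$, $b\in A_r^{(i)}$. -/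

import Mathlib

open scoped TensorProduct InnerProductSpace ENNReal ComplexOrder

noncomputable section

namespace BiFree

universe u v

/-! ### Hilbert space tensor products -/

section HilbertTensor

variable {E F E' F' G : Type*}
  [NormedAddCommGroup E] [InnerProductSpace ℂ E] [NormedAddCommGroup F] [InnerProductSpace ℂ F]
  [NormedAddCommGroup E'] [InnerProductSpace ℂ E'] [NormedAddCommGroup F'] [InnerProductSpace ℂ F']
  [NormedAddCommGroup G] [InnerProductSpace ℂ G]

/-- The Hilbert space tensor product: the completion of the algebraic tensor product for
`⟪a ⊗ b, c ⊗ d⟫ = ⟪a, c⟫ * ⟪b, d⟫`. -/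
def HilbertTensor (E F : Type*) [NormedAddCommGroup E] [InnerProductSpace ℂ E]
    [NormedAddCommGroup F] [InnerProductSpace ℂ F] : Type _ :=
  UniformSpace.Completion (E ⊗[ℂ] F)

instance : NormedAddCommGroup (HilbertTensor E F) :=
  inferInstanceAs (NormedAddCommGroup (UniformSpace.Completion (E ⊗[ℂ] F)))

instance : InnerProductSpace ℂ (HilbertTensor E F) :=
  inferInstanceAs (InnerProductSpace ℂ (UniformSpace.Completion (E ⊗[ℂ] F)))

instance : CompleteSpace (HilbertTensor E F) :=
  inferInstanceAs (CompleteSpace (UniformSpace.Completion (E ⊗[ℂ] F)))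

/-- The inclusion of the algebraic tensor product in its completion. -/
def toHilbertTensor : (E ⊗[ℂ] F) →ₗᵢ[ℂ] HilbertTensor E F :=
  (UniformSpace.Completion.toComplₗᵢ : (E ⊗[ℂ] F) →ₗᵢ[ℂ] UniformSpace.Completion (E ⊗[ℂ] F))

theorem denseRange_toHilbertTensor :
    DenseRange (toHilbertTensor : (E ⊗[ℂ] F) →ₗᵢ[ℂ] HilbertTensor E F) :=
  UniformSpace.Completion.denseRange_coe (α := E ⊗[ℂ] F)

/-- The elementary tensor `x ⊗ y` in the Hilbert space tensor product, bilinear in `x` and `y`. -/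
def htmul : E →ₗ[ℂ] F →ₗ[ℂ] HilbertTensor E F :=
  (TensorProduct.mk ℂ E F).compr₂ toHilbertTensor.toLinearMap

theorem htmul_eq (x : E) (y : F) : htmul x y = toHilbertTensor (x ⊗ₜ[ℂ] y) := rfl

theorem inner_htmul (x x' : E) (y y' : F) :
    ⟪htmul x y, htmul x' y'⟫_ℂ = ⟪x, x'⟫_ℂ * ⟪y, y'⟫_ℂ := by
  rw [htmul_eq, htmul_eq, LinearIsometry.inner_map_map, TensorProduct.inner_tmul]

theorem norm_htmul (x : E) (y : F) : ‖htmul x y‖ = ‖x‖ * ‖y‖ := by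
  rw [htmul_eq, LinearIsometry.norm_map, TensorProduct.norm_tmul]

/-- The bounded operator `S ⊗ T`. -/
def hmap (S : E →L[ℂ] E') (T : F →L[ℂ] F') : HilbertTensor E F →L[ℂ] HilbertTensor E' F' :=
  ((TensorProduct.mapL S T).completion :
    UniformSpace.Completion (E ⊗[ℂ] F) →L[ℂ] UniformSpace.Completion (E' ⊗[ℂ] F'))

theorem hmap_toHilbertTensor (S : E →L[ℂ] E') (T : F →L[ℂ] F') (x : E ⊗[ℂ] F) :
    hmap S T (toHilbertTensor x) = toHilbertTensor (TensorProduct.mapL S T x) :=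
  ContinuousLinearMap.completion_apply_coe _ _

theorem hmap_htmul (S : E →L[ℂ] E') (T : F →L[ℂ] F') (x : E) (y : F) :
    hmap S T (htmul x y) = htmul (S x) (T y) :=
  hmap_toHilbertTensor S T _

theorem norm_hmap_le (S : E →L[ℂ] E') (T : F →L[ℂ] F') : ‖hmap S T‖ ≤ ‖S‖ * ‖T‖ := by
  refine ContinuousLinearMap.opNorm_le_bound _ (by positivity) fun x => ?_
  refine denseRange_toHilbertTensor.induction_on x
    (isClosed_le (by fun_prop) (by fun_prop)) fun a => ?_
  rw [hmap_toHilbertTensor, LinearIsometry.norm_map, LinearIsometry.norm_map]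
  exact (ContinuousLinearMap.le_opNorm _ _).trans
    (mul_le_mul_of_nonneg_right (TensorProduct.norm_mapL_le S T) (norm_nonneg _))

theorem inner_lift_lift (B : E →ₗ[ℂ] F →ₗ[ℂ] G)
    (hB : ∀ x x' y y', ⟪B x y, B x' y'⟫_ℂ = ⟪x, x'⟫_ℂ * ⟪y, y'⟫_ℂ) (x y : E ⊗[ℂ] F) :
    ⟪TensorProduct.lift B x, TensorProduct.lift B y⟫_ℂ = ⟪x, y⟫_ℂ := by
  induction x using TensorProduct.induction_on with
  | zero => simp
  | add x₁ x₂ h₁ h₂ => simp only [map_add, inner_add_left, h₁, h₂]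
  | tmul a b =>
    induction y using TensorProduct.induction_on with
    | zero => simp
    | add y₁ y₂ h₁ h₂ => simp only [map_add, inner_add_right, h₁, h₂]
    | tmul c d => simp [hB]

/-- `x ⊗ y` as a bounded linear map in `y`. -/
def htmulL : E →ₗ[ℂ] F →L[ℂ] HilbertTensor E F where
  toFun x := (htmul x).mkContinuous ‖x‖ fun y => (norm_htmul x y).le
  map_add' x x' := by ext; simp
  map_smul' c x := by ext; simp

/-- `1 ⊗ T`, linear in `T`. -/
def hmapRight : (F →L[ℂ] F') →ₗ[ℂ] HilbertTensor E F →L[ℂ] HilbertTensor E F' where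
  toFun T := hmap (.id ℂ E) T
  map_add' S T := ContinuousLinearMap.ext fun x =>
    denseRange_toHilbertTensor.induction_on x
      (isClosed_eq (ContinuousLinearMap.continuous _) (ContinuousLinearMap.continuous _))
      fun a => by
        simp [hmap_toHilbertTensor, TensorProduct.mapL_add_right, -TensorProduct.mapL_apply]
  map_smul' c T := ContinuousLinearMap.ext fun x =>
    denseRange_toHilbertTensor.induction_on x
      (isClosed_eq (ContinuousLinearMap.continuous _) (ContinuousLinearMap.continuous _))
      fun a => by
        simp [hmap_toHilbertTensor, TensorProduct.mapL_smul_right, -TensorProduct.mapL_apply]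

theorem inner_hmap_id {S T : F →L[ℂ] F'} {c : ℂ} (h : ∀ y y', ⟪S y, T y'⟫_ℂ = c * ⟪y, y'⟫_ℂ)
    (x x' : HilbertTensor E F) :
    ⟪hmap (.id ℂ E) S x, hmap (.id ℂ E) T x'⟫_ℂ = c * ⟪x, x'⟫_ℂ := by
  refine denseRange_toHilbertTensor.induction_on₂ (isClosed_eq (by fun_prop) (by fun_prop))
    (fun a b => ?_) x x'
  rw [hmap_toHilbertTensor, hmap_toHilbertTensor, LinearIsometry.inner_map_map,
    LinearIsometry.inner_map_map]
  induction a using TensorProduct.induction_on with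
  | zero => simp
  | add a₁ a₂ h₁ h₂ => simp only [map_add, inner_add_left, h₁, h₂, mul_add]
  | tmul a y =>
    induction b using TensorProduct.induction_on with
    | zero => simp
    | add b₁ b₂ h₁ h₂ => simp only [map_add, inner_add_right, h₁, h₂, mul_add]
    | tmul b z =>
      simp only [TensorProduct.mapL_tmul, TensorProduct.inner_tmul, h,
        ContinuousLinearMap.id_apply]
      ring

/-- The continuous extension of a linear map from the algebraic tensor product. -/
def hextend [CompleteSpace G] (f : (E ⊗[ℂ] F) →L[ℂ] G) : HilbertTensor E F →L[ℂ] G :=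
  (f.fromCompletion : UniformSpace.Completion (E ⊗[ℂ] F) →L[ℂ] G)

theorem hextend_toHilbertTensor [CompleteSpace G] (f : (E ⊗[ℂ] F) →L[ℂ] G) (x : E ⊗[ℂ] F) :
    hextend f (toHilbertTensor x) = f x :=
  ContinuousLinearMap.fromCompletion_apply_coe _ _

/-- A bilinear map which multiplies inner products as the tensor product does extends to a
linear isometry of the Hilbert space tensor product. -/
def hlift [CompleteSpace G] (B : E →ₗ[ℂ] F →ₗ[ℂ] G)
    (hB : ∀ x x' y y', ⟪B x y, B x' y'⟫_ℂ = ⟪x, x'⟫_ℂ * ⟪y, y'⟫_ℂ) :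
    HilbertTensor E F →ₗᵢ[ℂ] G where
  toLinearMap := (hextend ((TensorProduct.lift B).isometryOfInner
    (inner_lift_lift B hB)).toContinuousLinearMap).toLinearMap
  norm_map' x := by
    refine denseRange_toHilbertTensor.induction_on x
      (isClosed_eq (ContinuousLinearMap.continuous _).norm continuous_norm) fun a => ?_
    rw [LinearIsometry.norm_map]
    exact (congrArg norm (hextend_toHilbertTensor _ a)).trans (LinearIsometry.norm_map _ a)

theorem hlift_htmul [CompleteSpace G] (B : E →ₗ[ℂ] F →ₗ[ℂ] G)
    (hB : ∀ x x' y y', ⟪B x y, B x' y'⟫_ℂ = ⟪x, x'⟫_ℂ * ⟪y, y'⟫_ℂ) (x : E) (y : F) :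
    hlift B hB (htmul x y) = B x y :=
  (hextend_toHilbertTensor _ _).trans (TensorProduct.lift.tmul x y)

end HilbertTensor

/-! ### States and the GNS construction -/

/-- A state: a linear functional with `φ 1 = 1` and `0 ≤ φ (a* a)` for all `a`. -/
structure State (A : Type*) [Ring A] [StarRing A] [Algebra ℂ A] extends A →ₗ[ℂ] ℂ where
  map_one' : toFun 1 = 1
  nonneg' : ∀ a, 0 ≤ toFun (star a * a)

namespace State

instance {A : Type*} [Ring A] [StarRing A] [Algebra ℂ A] : CoeFun (State A) (fun _ => A → ℂ) :=
  ⟨fun φ => φ.toLinearMap⟩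

/-- `φ` is faithful if `φ (a* a) = 0` only for `a = 0`. -/
def IsFaithful {A : Type*} [Ring A] [StarRing A] [Algebra ℂ A] (φ : State A) : Prop :=
  ∀ a, φ (star a * a) = 0 → a = 0

/-- The restriction of a state to a unital *-subalgebra. -/
def restrict {A : Type*} [Ring A] [StarRing A] [Algebra ℂ A] [StarModule ℂ A]
    (φ : State A) (S : StarSubalgebra ℂ A) : State S where
  toLinearMap := φ.toLinearMap ∘ₗ S.toSubalgebra.val.toLinearMap
  map_one' := φ.map_one'
  nonneg' a := φ.nonneg' (a : A)

end State

/-- A Hilbert space with a distinguished unit vector. -/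
structure PointedHilbert where
  carrier : Type u
  [normedAddCommGroup : NormedAddCommGroup carrier]
  [innerProductSpace : InnerProductSpace ℂ carrier]
  [completeSpace : CompleteSpace carrier]
  vacuum : carrier
  norm_vacuum : ‖vacuum‖ = 1

attribute [instance] PointedHilbert.normedAddCommGroup PointedHilbert.innerProductSpace
  PointedHilbert.completeSpace

section GNS

variable {A : Type u} [CStarAlgebra A] (φ : State A)

/-- A state as a positive linear map for the usual order of a C*-algebra (`0 ≤ a` iff `a` is
selfadjoint with nonnegative spectrum). -/
def State.toPositive : letI := CStarAlgebra.spectralOrder A; A →ₚ[ℂ] ℂ :=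
  letI := CStarAlgebra.spectralOrder A
  letI := CStarAlgebra.spectralOrderedRing A
  PositiveLinearMap.mk₀ φ.toLinearMap fun a ha => by
    obtain ⟨b, rfl⟩ := CStarAlgebra.nonneg_iff_eq_star_mul_self.mp ha
    exact φ.nonneg' b

/-- The GNS Hilbert space with its canonical cyclic vector, the class of `1`. -/
def State.gns : PointedHilbert.{u} :=
  letI := CStarAlgebra.spectralOrder A
  letI := CStarAlgebra.spectralOrderedRing A
  { carrier := φ.toPositive.GNS
    vacuum := ((φ.toPositive.toPreGNS 1 : φ.toPositive.PreGNS) : φ.toPositive.GNS)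
    norm_vacuum := by
      have h : φ.toPositive 1 = 1 := φ.map_one'
      rw [UniformSpace.Completion.norm_coe, PositiveLinearMap.preGNS_norm_def]
      simp [h] }

/-- The GNS representation `a ↦ (b ↦ a b)`. -/
def State.rep : A →⋆ₐ[ℂ] (φ.gns.carrier →L[ℂ] φ.gns.carrier) :=
  letI := CStarAlgebra.spectralOrder A
  letI := CStarAlgebra.spectralOrderedRing A
  φ.toPositive.gnsStarAlgHom

end GNS

/-! ### The minimal tensor product -/

section MinTensor

variable (A B : Type u) [CStarAlgebra A] [CStarAlgebra B]

/-- The bounded operators on the tensor product of the GNS spaces of two states. -/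
abbrev GNSTensorOp (p : State A × State B) : Type u :=
  HilbertTensor p.1.gns.carrier p.2.gns.carrier →L[ℂ]
    HilbertTensor p.1.gns.carrier p.2.gns.carrier

instance (p : State A × State B) :
    Nontrivial (HilbertTensor p.1.gns.carrier p.2.gns.carrier) :=
  ⟨⟨htmul p.1.gns.vacuum p.2.gns.vacuum, 0, fun h => by
    have := norm_htmul p.1.gns.vacuum p.2.gns.vacuum
    rw [h, p.1.gns.norm_vacuum, p.2.gns.norm_vacuum] at this
    simp at this⟩⟩

instance (p : State A × State B) : NormOneClass (GNSTensorOp A B p) := inferInstance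

variable {A B} in
/-- The family of operators `π_φ a ⊗ π_ψ b`, over all pairs of states `φ` of `A` and `ψ` of `B`. -/
def tensorFamily (a : A) (b : B) : lp (GNSTensorOp A B) ∞ :=
  ⟨fun p => hmap (p.1.rep a) (p.2.rep b), memℓp_infty ⟨‖a‖ * ‖b‖, by
    rintro _ ⟨p, rfl⟩
    exact (norm_hmap_le _ _).trans (mul_le_mul (NonUnitalStarAlgHom.norm_apply_le _ _)
      (NonUnitalStarAlgHom.norm_apply_le _ _) (norm_nonneg _) (norm_nonneg _))⟩⟩

/-- The minimal (spatial) tensor product of two unital C*-algebras: the C*-algebra generated by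
the elementary tensors `a ⊗ b` in the representation `⊕ π_φ ⊗ π_ψ` over all pairs of states, so
that `‖x‖ = sup ‖(π_φ ⊗ π_ψ) x‖` for `x` in the algebraic tensor product. -/
def MinTensor : StarSubalgebra ℂ (lp (GNSTensorOp A B) ∞) :=
  (StarAlgebra.adjoin ℂ {x | ∃ a b, x = tensorFamily (A := A) (B := B) a b}).topologicalClosure

variable {A B} in
/-- The elementary tensor `a ⊗ b` in the minimal tensor product. -/
def MinTensor.tmul (a : A) (b : B) : MinTensor A B :=
  ⟨tensorFamily a b, StarSubalgebra.le_topologicalClosure _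
    (StarAlgebra.subset_adjoin ℂ _ ⟨a, b, rfl⟩)⟩

end MinTensor

/-! ### The free product of Hilbert spaces -/

section FreeProduct

/-- The orthogonal complement of the distinguished vector. -/
abbrev PointedHilbert.reduced (P : PointedHilbert.{u}) : Submodule ℂ P.carrier :=
  (ℂ ∙ P.vacuum)ᗮ

/-- The component of a vector orthogonal to the distinguished vector. -/
def PointedHilbert.proj (P : PointedHilbert.{u}) : P.carrier →L[ℂ] P.reduced :=
  P.reduced.orthogonalProjectionOnto

theorem PointedHilbert.inner_eq (P : PointedHilbert.{u}) (x y : P.carrier) :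
    ⟪x, y⟫_ℂ = ⟪x, P.vacuum⟫_ℂ * ⟪P.vacuum, y⟫_ℂ + ⟪P.proj x, P.proj y⟫_ℂ := by
  have hx : ∀ z : P.carrier, z = ⟪P.vacuum, z⟫_ℂ • P.vacuum + (P.proj z : P.carrier) := by
    intro z
    have h := (ℂ ∙ P.vacuum).starProjection_add_starProjection_orthogonal z
    rw [Submodule.starProjection_unit_singleton ℂ P.norm_vacuum] at h
    exact h.symm
  have h0 : ∀ z : P.reduced, ⟪P.vacuum, (z : P.carrier)⟫_ℂ = 0 := fun z =>
    Submodule.mem_orthogonal_singleton_iff_inner_right.mp z.2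
  have h0' : ∀ z : P.reduced, ⟪(z : P.carrier), P.vacuum⟫_ℂ = 0 := fun z =>
    Submodule.mem_orthogonal_singleton_iff_inner_left.mp z.2
  have h1 : ⟪P.vacuum, P.vacuum⟫_ℂ = 1 := by
    rw [inner_self_eq_norm_sq_to_K, P.norm_vacuum]; simp
  conv_lhs => rw [hx x, hx y]
  simp only [inner_add_left, inner_add_right, inner_smul_left, inner_smul_right, h0, h0', h1,
    inner_conj_symm, Submodule.coe_inner]
  ring

section Concat

variable {α β : Type*} {K : β → Type*} [∀ b, NormedAddCommGroup (K b)]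

open Classical in
/-- Transport of a family along an injection, extended by zero. -/
def push (e : α ↪ β) (x : ∀ a, K (e a)) (b : β) : K b :=
  if h : ∃ a, e a = b then h.choose_spec ▸ x h.choose else 0

theorem push_apply (e : α ↪ β) (x : ∀ a, K (e a)) (a : α) : push e x (e a) = x a := by
  have h : ∃ a', e a' = e a := ⟨a, rfl⟩
  rw [push, dif_pos h]
  have key : ∀ (a' : α) (h' : e a' = e a), (h' ▸ x a' : K (e a)) = x a := by
    intro a' h'
    obtain rfl := e.injective h'
    rfl
  exact key _ _

theorem push_of_notMem (e : α ↪ β) (x : ∀ a, K (e a)) {b : β} (hb : b ∉ Set.range e) :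
    push e x b = 0 :=
  dif_neg hb

theorem memℓp_push (e : α ↪ β) {x : ∀ a, K (e a)} (hx : Memℓp x 2) : Memℓp (push (K := K) e x) 2 := by
  rw [memℓp_gen_iff (by norm_num)] at hx ⊢
  rw [← e.injective.summable_iff (fun b hb => by simp [push_of_notMem e x hb])]
  simpa [Function.comp_def, push_apply] using hx

variable [∀ b, InnerProductSpace ℂ (K b)]

/-- The isometric inclusion of the partial Hilbert sum over the range of `e`. -/
def pushLp (e : α ↪ β) : lp (fun a => K (e a)) 2 →ₗ[ℂ] lp K 2 where
  toFun x := ⟨push e x, memℓp_push e (lp.memℓp x)⟩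
  map_add' x y := lp.ext (funext fun b => by
    change push e (x + y) b = push e x b + push e y b
    by_cases hb : b ∈ Set.range e
    · obtain ⟨a, rfl⟩ := hb
      rw [push_apply, push_apply, push_apply]
      rfl
    · rw [push_of_notMem e _ hb, push_of_notMem e _ hb, push_of_notMem e _ hb, add_zero])
  map_smul' c x := lp.ext (funext fun b => by
    change push e (c • x) b = c • push e x b
    by_cases hb : b ∈ Set.range e
    · obtain ⟨a, rfl⟩ := hb
      rw [push_apply, push_apply]
      rfl
    · rw [push_of_notMem e _ hb, push_of_notMem e _ hb, smul_zero])

theorem pushLp_apply (e : α ↪ β) (x : lp (fun a => K (e a)) 2) (b : β) :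
    pushLp e x b = push e x b := rfl

theorem inner_pushLp (e : α ↪ β) (x y : lp (fun a => K (e a)) 2) :
    ⟪(pushLp e x : lp K 2), pushLp e y⟫_ℂ = ⟪x, y⟫_ℂ := by
  rw [lp.inner_eq_tsum, lp.inner_eq_tsum, ← e.injective.tsum_eq]
  · simp [pushLp_apply, push_apply]
  · intro b hb
    by_contra h
    exact hb (by simp [pushLp_apply, push_of_notMem e _ h])

theorem inner_pushLp_of_disjoint (e e' : α ↪ β) (h : ∀ a a', e a ≠ e' a')
    (x : lp (fun a => K (e a)) 2) (y : lp (fun a => K (e' a)) 2) :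
    ⟪(pushLp e x : lp K 2), pushLp e' y⟫_ℂ = 0 := by
  rw [lp.inner_eq_tsum]
  refine (tsum_congr fun b => ?_).trans tsum_zero
  by_cases hb : b ∈ Set.range e
  · obtain ⟨a, rfl⟩ := hb
    have : e a ∉ Set.range e' := by rintro ⟨a', ha'⟩; exact h a a' ha'.symm
    simp [pushLp_apply, push_of_notMem e' _ this]
  · simp [pushLp_apply, push_of_notMem e _ hb]

variable {E : Type*} [NormedAddCommGroup E] [InnerProductSpace ℂ E]

section mapLp

variable {G G' : α → Type*} [∀ a, NormedAddCommGroup (G a)] [∀ a, InnerProductSpace ℂ (G a)]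
  [∀ a, NormedAddCommGroup (G' a)] [∀ a, InnerProductSpace ℂ (G' a)]
  (c : ∀ a, E →ₗ[ℂ] G a →ₗ[ℂ] G' a)

theorem memℓp_map
    (hc : ∀ a x x' y y', ⟪c a x y, c a x' y'⟫_ℂ = ⟪x, x'⟫_ℂ * ⟪y, y'⟫_ℂ)
    (h : E) (x : lp G 2) : Memℓp (fun a => c a h (x a)) 2 := by
  have hn : ∀ a, ‖c a h (x a)‖ = ‖h‖ * ‖x a‖ := fun a => by
    have := hc a h h (x a) (x a)
    rw [inner_self_eq_norm_sq_to_K, inner_self_eq_norm_sq_to_K,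
      inner_self_eq_norm_sq_to_K, ← mul_pow] at this
    norm_cast at this
    exact (pow_left_inj₀ (norm_nonneg _) (by positivity) two_ne_zero).mp this
  have hx := (lp.memℓp x).summable (by norm_num)
  rw [memℓp_gen_iff (by norm_num)]
  refine (hx.mul_left (‖h‖ ^ (2 : ℝ≥0∞).toReal)).congr fun a => ?_
  rw [hn, Real.mul_rpow (norm_nonneg _) (norm_nonneg _)]

/-- Componentwise application of bilinear maps in a Hilbert sum. -/
def mapLp (hc : ∀ a x x' y y', ⟪c a x y, c a x' y'⟫_ℂ = ⟪x, x'⟫_ℂ * ⟪y, y'⟫_ℂ) :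
    E →ₗ[ℂ] lp G 2 →ₗ[ℂ] lp G' 2 :=
  LinearMap.mk₂ ℂ (fun h x => ⟨fun a => c a h (x a), memℓp_map c hc h x⟩)
    (fun h h' x => lp.ext (funext fun a => (c a).map_add₂ h h' (x a)))
    (fun r h x => lp.ext (funext fun a => (c a).map_smul₂ r h (x a)))
    (fun h x y => lp.ext (funext fun a => (c a h).map_add (x a) (y a)))
    (fun r h x => lp.ext (funext fun a => (c a h).map_smul r (x a)))

theorem inner_mapLp
    (hc : ∀ a x x' y y', ⟪c a x y, c a x' y'⟫_ℂ = ⟪x, x'⟫_ℂ * ⟪y, y'⟫_ℂ)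
    (h h' : E) (x y : lp G 2) :
    ⟪mapLp c hc h x, mapLp c hc h' y⟫_ℂ = ⟪h, h'⟫_ℂ * ⟪x, y⟫_ℂ := by
  rw [lp.inner_eq_tsum, lp.inner_eq_tsum, ← tsum_mul_left]
  exact tsum_congr fun a => hc a h h' (x a) (y a)

end mapLp

variable (Q : PointedHilbert.{u}) (e₀ e₁ : α ↪ β)
  (c : ∀ a, Q.reduced →ₗ[ℂ] K (e₀ a) →ₗ[ℂ] K (e₁ a))
  (hc : ∀ a x x' y y', ⟪c a x y, c a x' y'⟫_ℂ = ⟪x, x'⟫_ℂ * ⟪y, y'⟫_ℂ)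

/-- The concatenation map: if `h = z • ξ + h°` with `h°` orthogonal to the distinguished vector
`ξ`, then `(h, x)` is sent to `z • x`, which lives on the range of `e₀`, plus the family of the
`c a h° (x a)`, which lives on the range of `e₁`. -/
def concat : Q.carrier →ₗ[ℂ] lp (fun a => K (e₀ a)) 2 →ₗ[ℂ] lp K 2 :=
  LinearMap.mk₂ ℂ
    (fun h x => ⟪Q.vacuum, h⟫_ℂ • pushLp e₀ x + pushLp e₁ (mapLp c hc (Q.proj h) x))
    (fun h h' x => by
      simp only [inner_add_right, map_add, add_smul, LinearMap.add_apply]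
      abel)
    (fun r h x => by
      simp only [inner_smul_right, map_smul, smul_add, LinearMap.smul_apply, mul_smul])
    (fun h x y => by
      simp only [map_add, smul_add]
      abel)
    (fun r h x => by
      simp only [map_smul, smul_add]
      rw [smul_comm])

theorem concat_apply (h : Q.carrier) (x : lp (fun a => K (e₀ a)) 2) :
    concat Q e₀ e₁ c hc h x =
      ⟪Q.vacuum, h⟫_ℂ • pushLp e₀ x + pushLp e₁ (mapLp c hc (Q.proj h) x) := rfl

theorem inner_concat (hdisj : ∀ a a', e₀ a ≠ e₁ a') (h h' : Q.carrier) (x y : lp (fun a => K (e₀ a)) 2) :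
    ⟪concat Q e₀ e₁ c hc h x, concat Q e₀ e₁ c hc h' y⟫_ℂ = ⟪h, h'⟫_ℂ * ⟪x, y⟫_ℂ := by
  simp only [concat_apply, inner_add_left, inner_add_right, inner_smul_left, inner_smul_right,
    inner_pushLp, inner_mapLp, inner_pushLp_of_disjoint e₀ e₁ hdisj,
    inner_pushLp_of_disjoint e₁ e₀ (fun a a' => (hdisj a' a).symm), Q.inner_eq h h',
    inner_conj_symm]
  ring

theorem concat_apply_left (hdisj : ∀ a a', e₀ a ≠ e₁ a') (h : Q.carrier)
    (x : lp (fun a => K (e₀ a)) 2) (a : α) :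
    concat Q e₀ e₁ c hc h x (e₀ a) = ⟪Q.vacuum, h⟫_ℂ • x a := by
  have h₁ : e₀ a ∉ Set.range e₁ := by rintro ⟨a', ha'⟩; exact hdisj a a' ha'.symm
  change ⟪Q.vacuum, h⟫_ℂ • push e₀ x (e₀ a) + push e₁ (mapLp c hc (Q.proj h) x) (e₀ a) = _
  rw [push_of_notMem e₁ _ h₁, push_apply, add_zero]

theorem concat_apply_right (hdisj : ∀ a a', e₀ a ≠ e₁ a') (h : Q.carrier)
    (x : lp (fun a => K (e₀ a)) 2) (a : α) :
    concat Q e₀ e₁ c hc h x (e₁ a) = c a (Q.proj h) (x a) := by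
  have h₀ : e₁ a ∉ Set.range e₀ := by rintro ⟨a', ha'⟩; exact hdisj a' a ha'
  change ⟪Q.vacuum, h⟫_ℂ • push e₀ x (e₁ a) + push e₁ (mapLp c hc (Q.proj h) x) (e₁ a) = _
  rw [push_of_notMem e₀ _ h₀, push_apply, smul_zero, zero_add]
  rfl

end Concat

/-- A Hilbert space, bundled so that families can be defined by recursion. -/
structure HilbertSpace where
  carrier : Type u
  [normedAddCommGroup : NormedAddCommGroup carrier]
  [innerProductSpace : InnerProductSpace ℂ carrier]
  [completeSpace : CompleteSpace carrier]

attribute [instance] HilbertSpace.normedAddCommGroup HilbertSpace.innerProductSpace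
  HilbertSpace.completeSpace

variable {I : Type v} (P : I → PointedHilbert.{u})

/-- For `w = [i₁, …, iₙ]`, the Hilbert space tensor product `H°_{i₁} ⊗ ⋯ ⊗ H°_{iₙ}`, where
`H°_i` is the orthogonal complement of the distinguished vector; for the empty list, the
one-dimensional space. -/
def wordHilbert : List I → HilbertSpace.{u}
  | [] => ⟨EuclideanSpace ℂ PUnit.{u + 1}⟩
  | i :: w => ⟨HilbertTensor (P i).reduced (wordHilbert w).carrier⟩

/-- The Hilbert space of a word. -/
abbrev WordSpace (w : List I) : Type u := (wordHilbert P w).carrier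

/-- The map `(h, t) ↦ h ⊗ t` from `H°_i × (H°_{i₁} ⊗ ⋯ ⊗ H°_{iₙ})` to
`H°_i ⊗ H°_{i₁} ⊗ ⋯ ⊗ H°_{iₙ}`. -/
def consTensor (i : I) (w : List I) :
    (P i).reduced →ₗ[ℂ] WordSpace P w →ₗ[ℂ] WordSpace P (i :: w) :=
  (htmul : (P i).reduced →ₗ[ℂ] WordSpace P w →ₗ[ℂ] HilbertTensor (P i).reduced (WordSpace P w))

/-- The map `(h, t) ↦ t ⊗ h` from `H°_i × (H°_{i₁} ⊗ ⋯ ⊗ H°_{iₙ})` to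
`H°_{i₁} ⊗ ⋯ ⊗ H°_{iₙ} ⊗ H°_i`, by recursion on the word. -/
def snocTensor (i : I) :
    (w : List I) → (P i).reduced →ₗ[ℂ] WordSpace P w →L[ℂ] WordSpace P (w ++ [i])
  | [] => (htmulL : (P i).reduced →ₗ[ℂ] WordSpace P [] →L[ℂ]
      HilbertTensor (P i).reduced (WordSpace P []))
  | j :: w => (hmapRight.comp (snocTensor i w) : (P i).reduced →ₗ[ℂ]
      HilbertTensor (P j).reduced (WordSpace P w) →L[ℂ]
      HilbertTensor (P j).reduced (WordSpace P (w ++ [i])))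

theorem inner_consTensor (i : I) (w : List I) (h h' : (P i).reduced) (t t' : WordSpace P w) :
    ⟪consTensor P i w h t, consTensor P i w h' t'⟫_ℂ = ⟪h, h'⟫_ℂ * ⟪t, t'⟫_ℂ :=
  inner_htmul h h' t t'

theorem inner_snocTensor (i : I) (w : List I) (h h' : (P i).reduced) (t t' : WordSpace P w) :
    ⟪snocTensor P i w h t, snocTensor P i w h' t'⟫_ℂ = ⟪h, h'⟫_ℂ * ⟪t, t'⟫_ℂ := by
  induction w with
  | nil => exact inner_htmul h h' t t'
  | cons j w ih => exact inner_hmap_id (fun y y' => ih y y') t t'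

/-- The alternating words `i₁ ≠ i₂ ≠ ⋯ ≠ iₙ`, including the empty one. -/
abbrev AltWord (I : Type v) : Type v := {w : List I // w.IsChain (· ≠ ·)}

/-- The alternating words that do not start with `i`. -/
abbrev AltWordL (i : I) : Type v := {w : AltWord I // w.1.head? ≠ some i}

/-- The alternating words that do not end with `i`. -/
abbrev AltWordR (i : I) : Type v := {w : AltWord I // w.1.getLast? ≠ some i}

/-- Putting the letter `i` in front of a word. -/
def consWord (i : I) : AltWordL i ↪ AltWord I where
  toFun w := ⟨i :: w.1.1, by
    refine List.isChain_cons.mpr ⟨fun j hj hij => w.2 ?_, w.1.2⟩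
    exact hj.trans (congrArg some hij.symm)⟩
  inj' w w' h := Subtype.ext (Subtype.ext (List.cons_injective (congrArg Subtype.val h)))

/-- Putting the letter `i` at the end of a word. -/
def snocWord (i : I) : AltWordR i ↪ AltWord I where
  toFun w := ⟨w.1.1 ++ [i], by
    refine List.isChain_append.mpr ⟨w.1.2, List.isChain_singleton i, fun j hj k hk hjk => w.2 ?_⟩
    obtain rfl : i = k := by simpa using hk
    exact hj.trans (congrArg some hjk)⟩
  inj' w w' h := Subtype.ext (Subtype.ext (List.append_left_injective [i] (congrArg Subtype.val h)))

theorem ne_consWord (i : I) (w w' : AltWordL i) : w.1 ≠ consWord i w' := fun h =>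
  w.2 (by rw [h]; rfl)

theorem ne_snocWord (i : I) (w w' : AltWordR i) : w.1 ≠ snocWord i w' := fun h =>
  w.2 (by rw [h]; exact List.getLast?_concat)

/-- The free product Hilbert space `H = ℂξ ⊕ ⨁ H°_{i₁} ⊗ ⋯ ⊗ H°_{iₙ}`. -/
abbrev FreeProduct : Type (max u v) := lp (fun w : AltWord I => WordSpace P w.1) 2

/-- The Hilbert space `H(l, i)`: the partial sum over the words that do not start with `i`. -/
abbrev FreeProductL (i : I) : Type (max u v) := lp (fun w : AltWordL i => WordSpace P w.1.1) 2

/-- The Hilbert space `H(r, i)`: the partial sum over the words that do not end with `i`. -/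
abbrev FreeProductR (i : I) : Type (max u v) := lp (fun w : AltWordR i => WordSpace P w.1.1) 2

open Classical in
/-- The distinguished vector `ξ` of the free product. -/
def freeVacuum : FreeProduct P :=
  lp.single 2 (⟨[], List.isChain_nil⟩ : AltWord I)
    (EuclideanSpace.single PUnit.unit (1 : ℂ) : EuclideanSpace ℂ PUnit.{u + 1})

theorem norm_freeVacuum : ‖freeVacuum P‖ = 1 := by
  classical
  have h : ‖(EuclideanSpace.single PUnit.unit (1 : ℂ) : EuclideanSpace ℂ PUnit.{u + 1})‖ = 1 := by
    simp
  exact (lp.norm_single (by norm_num) _ _).trans h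

/-- The concatenation map `H_i × H(l, i) → H`, `(h, x) ↦ h ⊗ x`, where the distinguished vectors
of `H_i` and of `H(l, i)` are absorbed. -/
def leftConcat (i : I) : (P i).carrier →ₗ[ℂ] FreeProductL P i →ₗ[ℂ] FreeProduct P :=
  concat (K := fun w : AltWord I => WordSpace P w.1) (P i) (Function.Embedding.subtype _)
    (consWord i) (fun w => consTensor P i w.1.1) (fun w => inner_consTensor P i w.1.1)

theorem inner_leftConcat (i : I) (h h' : (P i).carrier) (x x' : FreeProductL P i) :
    ⟪leftConcat P i h x, leftConcat P i h' x'⟫_ℂ = ⟪h, h'⟫_ℂ * ⟪x, x'⟫_ℂ :=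
  inner_concat _ _ _ _ _ (ne_consWord i) _ _ _ _

/-- The concatenation map `H_i × H(r, i) → H`, `(h, x) ↦ x ⊗ h`, where the distinguished vectors
of `H_i` and of `H(r, i)` are absorbed. -/
def rightConcat (i : I) : (P i).carrier →ₗ[ℂ] FreeProductR P i →ₗ[ℂ] FreeProduct P :=
  concat (K := fun w : AltWord I => WordSpace P w.1) (P i) (Function.Embedding.subtype _)
    (snocWord i) (fun w => ContinuousLinearMap.coeLM ℂ ∘ₗ snocTensor P i w.1.1)
    (fun w => inner_snocTensor P i w.1.1)

theorem inner_rightConcat (i : I) (h h' : (P i).carrier) (x x' : FreeProductR P i) :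
    ⟪rightConcat P i h x, rightConcat P i h' x'⟫_ℂ = ⟪h, h'⟫_ℂ * ⟪x, x'⟫_ℂ :=
  inner_concat _ _ _ _ _ (ne_snocWord i) _ _ _ _

/-- The concatenation unitary `V_i : H_i ⊗ H(l, i) → H`, as a linear isometry (it is onto since
every alternating word either does not start with `i` or is `i` followed by such a word). -/
def leftUnitary (i : I) : HilbertTensor (P i).carrier (FreeProductL P i) →ₗᵢ[ℂ] FreeProduct P :=
  hlift (leftConcat P i) (inner_leftConcat P i)

/-- The concatenation unitary `W_i : H(r, i) ⊗ H_i → H`, as a linear isometry (it is onto since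
every alternating word either does not end with `i` or is such a word followed by `i`). -/
def rightUnitary (i : I) : HilbertTensor (FreeProductR P i) (P i).carrier →ₗᵢ[ℂ] FreeProduct P :=
  hlift (rightConcat P i).flip
    (fun x x' h h' => (inner_rightConcat P i h h' x x').trans (mul_comm _ _))

/-- The left representation `λ_i(T) = V_i (T ⊗ 1) V_i*`. -/
def leftRep (i : I) (T : (P i).carrier →L[ℂ] (P i).carrier) : FreeProduct P →L[ℂ] FreeProduct P :=
  (leftUnitary P i).toContinuousLinearMap ∘L hmap T (.id ℂ _) ∘L
    (leftUnitary P i).toContinuousLinearMap.adjoint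

/-- The right representation `ρ_i(T) = W_i (1 ⊗ T) W_i*`. -/
def rightRep (i : I) (T : (P i).carrier →L[ℂ] (P i).carrier) : FreeProduct P →L[ℂ] FreeProduct P :=
  (rightUnitary P i).toContinuousLinearMap ∘L hmap (.id ℂ _) T ∘L
    (rightUnitary P i).toContinuousLinearMap.adjoint

end FreeProduct

/-! ### Families of pairs of faces -/

/-- A pair of faces: two unital C*-subalgebras of `A`. -/
structure PairOfFaces (A : Type u) [CStarAlgebra A] where
  left : StarSubalgebra ℂ A
  right : StarSubalgebra ℂ A
  isClosed_left : IsClosed (left : Set A)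
  isClosed_right : IsClosed (right : Set A)

section Faces

variable {A : Type u} [CStarAlgebra A]

instance (F : PairOfFaces A) : CStarAlgebra F.left :=
  StarSubalgebra.cstarAlgebra F.left (h_closed := F.isClosed_left)

instance (F : PairOfFaces A) : CStarAlgebra F.right :=
  StarSubalgebra.cstarAlgebra F.right (h_closed := F.isClosed_right)

/-- The C*-algebra `C*(A_l, A_r)` generated by a pair of faces. -/
def PairOfFaces.generated (F : PairOfFaces A) : StarSubalgebra ℂ A :=
  (F.left ⊔ F.right).topologicalClosure

instance (F : PairOfFaces A) : CStarAlgebra F.generated :=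
  StarSubalgebra.cstarAlgebra F.generated
    (h_closed := StarSubalgebra.isClosed_topologicalClosure _)

theorem PairOfFaces.left_le (F : PairOfFaces A) : F.left ≤ F.generated :=
  le_sup_left.trans (StarSubalgebra.le_topologicalClosure _)

theorem PairOfFaces.right_le (F : PairOfFaces A) : F.right ≤ F.generated :=
  le_sup_right.trans (StarSubalgebra.le_topologicalClosure _)

/-- The inclusion of the left face in the generated algebra. -/
def PairOfFaces.inl (F : PairOfFaces A) : F.left →⋆ₐ[ℂ] F.generated :=
  StarSubalgebra.inclusion F.left_le

/-- The inclusion of the right face in the generated algebra. -/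
def PairOfFaces.inr (F : PairOfFaces A) : F.right →⋆ₐ[ℂ] F.generated :=
  StarSubalgebra.inclusion F.right_le

variable {I : Type v} (φ : State A) (F : I → PairOfFaces A)

/-- A family of pairs of faces is non-trivial if it has at least two members and none of them
generates only the scalars. -/
def IsNontrivialFamily (F : I → PairOfFaces A) : Prop :=
  Nontrivial I ∧ ∀ i, (F i).generated ≠ ⊥

/-- The restriction `φ_i` of `φ` to the algebra generated by the `i`-th pair of faces. -/
def faceState (i : I) : State (F i).generated := φ.restrict (F i).generated

/-- The GNS space of `φ_i`, with its canonical cyclic vector. -/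
def faceHilbert (i : I) : PointedHilbert.{u} := (faceState φ F i).gns

/-- The GNS representation of `φ_i`. -/
def faceRep (i : I) :
    (F i).generated →⋆ₐ[ℂ] ((faceHilbert φ F i).carrier →L[ℂ] (faceHilbert φ F i).carrier) :=
  (faceState φ F i).rep

/-- The reduced bi-free product: the C*-algebra generated by the left faces, acting by
`λ_i ∘ π_i`, and the right faces, acting by `ρ_i ∘ π_i`, on the free product of the GNS spaces. -/
def biFreeProduct : StarSubalgebra ℂ
    (FreeProduct (faceHilbert φ F) →L[ℂ] FreeProduct (faceHilbert φ F)) :=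
  (StarAlgebra.adjoin ℂ
    ({T | ∃ (i : I) (a : (F i).left), T = leftRep _ i (faceRep φ F i ((F i).inl a))} ∪
      {T | ∃ (i : I) (b : (F i).right), T = rightRep _ i (faceRep φ F i ((F i).inr b))}
    )).topologicalClosure

/-- The bi-free product state `T ↦ ⟨T ξ, ξ⟩` on the reduced bi-free product. -/
def biFreeState : State (biFreeProduct φ F) where
  toFun T := ⟪freeVacuum (faceHilbert φ F), T.1 (freeVacuum (faceHilbert φ F))⟫_ℂ
  map_add' S T := inner_add_right _ _ _
  map_smul' c T := inner_smul_right _ _ _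
  map_one' := by
    change ⟪freeVacuum (faceHilbert φ F), freeVacuum (faceHilbert φ F)⟫_ℂ = 1
    rw [inner_self_eq_norm_sq_to_K, norm_freeVacuum]
    simp
  nonneg' T := by
    change 0 ≤ ⟪freeVacuum (faceHilbert φ F),
      (T.1.adjoint ∘L T.1) (freeVacuum (faceHilbert φ F))⟫_ℂ
    rw [ContinuousLinearMap.comp_apply, ContinuousLinearMap.adjoint_inner_right,
      inner_self_eq_norm_sq_to_K]
    norm_cast
    positivity

end Faces

end BiFree

end

/-! Faithfulness of the bi-free product state says exactly that the vacuum ξ is separating for the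
reduced bi-free product D: an operator of D is determined by its value at ξ
(`eq_zero_of_apply_freeVacuum`). Three consequences carry the proof.

Copies of C_i in D. On the copy of H_i in H both λ_i(T) and ρ_i(T) act as T. Compression to H_i is
injective on the part of D reduced by it, since ξ lies in H_i. It is therefore isometric, its range
contains π_i(C_i), and inverting it gives an injective homomorphism θ from C_i to D that extends λ_i
∘ π_i and ρ_i ∘ π_i on the faces (`exists_dilation`, `exists_faceDilation`).

Commutation. Fix j ≠ i. On vectors η ⊗ k ⊗ ζ with η, ζ in H_i and k in H°_j (`sandwich`), λ_i moves
only η and ρ_i only ζ, so commutators of the two faces kill H°_j. An operator of D that kills H°_j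
is zero (`eq_zero_of_apply_letter`), hence the faces commute.

The minimal norm. For a unit vector k, the vectors η ⊗ k ⊗ ζ turn θ into product functionals on A_l
⊙ A_r, so these are bounded by the norm of C_i. A numerical radius argument
(`State.norm_le_of_forall_inner`) passes from vector functionals to all pairs of states, so C_i is
represented on every tensor product of GNS spaces. One of these representations is faithful: the
functional at ξ_i ⊗ k ⊗ ξ_i depends on k only through ‖k‖, so if it vanishes at c*c then θ(c) kills
all of H°_j, and c = 0 (`exists_isFaithful_state`). The sum of the representations is then
isometric, with image the minimal tensor product (`exists_starAlgEquiv_minTensor`). -/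

noncomputable section

namespace BiFree

universe u v w

/-! ### GNS vectors and the numerical radius bound for states. -/

section StateLemmas

variable {A : Type u} [CStarAlgebra A] (φ : State A)

/-- An equality of functions, so that density of the classes can be transported by rewriting. The
order is introduced locally because the algebra carries none by default. -/
theorem State.rep_vacuum :
    letI := CStarAlgebra.spectralOrder A
    letI := CStarAlgebra.spectralOrderedRing A
    (fun a => φ.rep a φ.gns.vacuum) =
      fun a => ((φ.toPositive.toPreGNS a : φ.toPositive.PreGNS) : φ.toPositive.GNS) := by
  let _ := CStarAlgebra.spectralOrder A
  let _ := CStarAlgebra.spectralOrderedRing A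
  funext a
  refine (PositiveLinearMap.gnsNonUnitalStarAlgHom_apply_coe (f := φ.toPositive) (a := a)
    (b := φ.toPositive.toPreGNS 1)).trans ?_
  rw [PositiveLinearMap.leftMulMapPreGNS_apply]
  simp

theorem State.inner_rep_vacuum (a b : A) :
    ⟪φ.rep a φ.gns.vacuum, φ.rep b φ.gns.vacuum⟫_ℂ = φ (star a * b) := by
  let _ := CStarAlgebra.spectralOrder A
  let _ := CStarAlgebra.spectralOrderedRing A
  rw [congrFun φ.rep_vacuum a, congrFun φ.rep_vacuum b]
  exact UniformSpace.Completion.inner_coe _ _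

theorem State.denseRange_rep_vacuum : DenseRange fun a => φ.rep a φ.gns.vacuum := by
  let _ := CStarAlgebra.spectralOrder A
  let _ := CStarAlgebra.spectralOrderedRing A
  rw [φ.rep_vacuum]
  exact (UniformSpace.Completion.denseRange_coe (α := φ.toPositive.PreGNS)).comp
    φ.toPositive.toPreGNS.surjective.denseRange (UniformSpace.Completion.continuous_coe _)

variable {φ} in
theorem State.IsFaithful.rep_injective (hφ : φ.IsFaithful) : Function.Injective φ.rep := by
  refine (injective_iff_map_eq_zero _).mpr fun a ha => hφ a ?_
  rw [← φ.inner_rep_vacuum, ha]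
  simp

theorem State.map_star (a : A) : φ (star a) = starRingEnd ℂ (φ a) := by
  rw [← mul_one (star a), ← φ.inner_rep_vacuum, ← inner_conj_symm, φ.inner_rep_vacuum]
  simp

theorem State.map_one : φ 1 = 1 := φ.map_one'

/-- States are bounded by the numerical radius of any faithful representation. -/
theorem State.norm_le_of_forall_inner {H : Type v} [NormedAddCommGroup H] [InnerProductSpace ℂ H]
    [CompleteSpace H] (π : A →⋆ₐ[ℂ] (H →L[ℂ] H)) (hπ : Function.Injective π) {y : A} {N : ℝ}
    (h : ∀ η : H, ‖⟪η, π y η⟫_ℂ‖ ≤ N * ‖η‖ ^ 2) : ‖φ y‖ ≤ N := by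
  -- A phase `c` that rotates `φ y` to its modulus.
  obtain ⟨c, hc, hcy⟩ : ∃ c : ℂ, ‖c‖ = 1 ∧ c * φ y = (‖φ y‖ : ℂ) := by
    by_cases h0 : φ y = 0
    · exact ⟨1, by simp, by simp [h0]⟩
    · refine ⟨(‖φ y‖ : ℂ) / φ y, ?_, div_mul_cancel₀ _ h0⟩
      rw [norm_div, Complex.norm_real, norm_norm, div_self (norm_ne_zero_iff.mpr h0)]
  let _ := CStarAlgebra.spectralOrder A
  let _ := CStarAlgebra.spectralOrderedRing A
  -- `k` is 2N − 2 Re(cy). The numerical radius bound makes `π k` positive, and `φ k ≥ 0` is the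
  -- claim.
  set k : A := (2 * N : ℂ) • (1 : A) - (c • y + star (c • y)) with hk
  have hsa : IsSelfAdjoint k := by
    simp [hk, isSelfAdjoint_iff, add_comm]
  have hpos : (π k).IsPositive := by
    refine ⟨?_, fun η => ?_⟩
    · exact ContinuousLinearMap.isSelfAdjoint_iff_isSymmetric.mp (hsa.map π)
    · have hy := (Complex.re_le_norm (c * ⟪η, π y η⟫_ℂ)).trans
        ((by rw [norm_mul, hc, one_mul] : ‖c * ⟪η, π y η⟫_ℂ‖ = _).trans_le (h η))
      have h1 : ⟪η, π k η⟫_ℂ = 2 * N * ‖η‖ ^ 2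
          - (c * ⟪η, π y η⟫_ℂ + starRingEnd ℂ (c * ⟪η, π y η⟫_ℂ)) := by
        have h2 : ⟪η, π (star (c • y)) η⟫_ℂ = starRingEnd ℂ (c * ⟪η, π y η⟫_ℂ) := by
          rw [StarHomClass.map_star, ContinuousLinearMap.star_eq_adjoint,
            ContinuousLinearMap.adjoint_inner_right, map_smul, ← inner_conj_symm,
            smul_apply, inner_smul_right]
        rw [hk, map_sub, map_add, sub_apply, add_apply,
          inner_sub_right, inner_add_right, h2, map_smul, map_smul, _root_.map_one,
          smul_apply, smul_apply, inner_smul_right,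
          inner_smul_right, one_apply_eq_self, inner_self_eq_norm_sq_to_K]
        simp
      rw [ContinuousLinearMap.reApplyInnerSelf_apply, inner_re_symm, h1]
      have h3 : (2 * N * ‖η‖ ^ 2 : ℂ) = ((2 * N * ‖η‖ ^ 2 : ℝ) : ℂ) := by push_cast; rfl
      rw [Complex.add_conj, h3, ← Complex.ofReal_sub]
      simp only [RCLike.re_to_complex, Complex.ofReal_re]
      linarith
  have hk0 : 0 ≤ k := by
    -- An injective representation preserves the spectrum, so positivity of `π k` descends to `k`.
    rw [StarOrderedRing.nonneg_iff_spectrum_nonneg (R := ℝ) k hsa,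
      ← hsa.map_spectrum_real π hπ]
    exact fun x hx => (SpectrumRestricts.nnreal_iff.mp hpos.spectrumRestricts) x hx
  obtain ⟨b, hb⟩ := CStarAlgebra.nonneg_iff_eq_star_mul_self.mp hk0
  have hφk : 0 ≤ φ k := hb ▸ φ.nonneg' b
  have : φ k = 2 * N - 2 * ‖φ y‖ := by
    have hs : φ (star (c • y)) = (‖φ y‖ : ℂ) := by
      rw [φ.map_star, map_smul, smul_eq_mul, hcy, Complex.conj_ofReal]
    rw [hk, map_sub, map_add, hs, map_smul, map_smul, smul_eq_mul, smul_eq_mul, hcy, φ.map_one]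
    ring
  rw [this] at hφk
  have h2 := (Complex.nonneg_iff.mp hφk).1
  simp at h2
  linarith

end StateLemmas

/-! ### Product states and representations on tensor products of GNS spaces. -/

section TensorRep

/-- Two linear maps with dense ranges and equal norms differ by a unitary. -/
theorem exists_linearIsometryEquiv_of_denseRange {V H K : Type*} [AddCommGroup V] [Module ℂ V]
    [NormedAddCommGroup H] [InnerProductSpace ℂ H] [CompleteSpace H]
    [NormedAddCommGroup K] [InnerProductSpace ℂ K] [CompleteSpace K]
    {s : V →ₗ[ℂ] H} {r : V →ₗ[ℂ] K} (hs : DenseRange s) (hr : DenseRange r)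
    (h : ∀ x, ‖r x‖ = ‖s x‖) : ∃ U : H ≃ₗᵢ[ℂ] K, ∀ x, U (s x) = r x :=
  ⟨(LinearEquiv.refl ℂ V).extendOfIsometry s r hs hr h,
    fun x => LinearEquiv.extendOfIsometry_eq (LinearEquiv.refl ℂ V) s r hs hr h x⟩

/-- The conjugation of a representation by a unitary. -/
def conjRep {C H K : Type*} [Semiring C] [StarRing C] [Algebra ℂ C]
    [NormedAddCommGroup H] [InnerProductSpace ℂ H] [CompleteSpace H]
    [NormedAddCommGroup K] [InnerProductSpace ℂ K] [CompleteSpace K]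
    (π : C →⋆ₐ[ℂ] (H →L[ℂ] H)) (U : H ≃ₗᵢ[ℂ] K) : C →⋆ₐ[ℂ] (K →L[ℂ] K) where
  toFun c := U.conjStarAlgEquiv (π c)
  map_one' := by rw [map_one, map_one]
  map_mul' x y := by rw [map_mul, map_mul]
  map_zero' := by rw [map_zero, map_zero]
  map_add' x y := by rw [map_add, map_add]
  commutes' r := by rw [AlgHomClass.commutes π, AlgHomClass.commutes U.conjStarAlgEquiv]
  map_star' x := by rw [map_star, map_star]

/-- An injective *-homomorphism is an isomorphism onto its image. -/
theorem exists_starAlgEquiv_of_range {C D : Type*} [Semiring C] [StarRing C] [Algebra ℂ C]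
    [Semiring D] [StarRing D] [Algebra ℂ D] [StarModule ℂ D] (f : C →⋆ₐ[ℂ] D)
    (hf : Function.Injective f) (S : StarSubalgebra ℂ D) (hS : ∀ y, y ∈ S ↔ ∃ c, f c = y) :
    ∃ e : C ≃⋆ₐ[ℂ] S, ∀ c, (e c : D) = f c := by
  refine ⟨StarAlgEquiv.ofBijective (f.codRestrict S fun c => (hS _).mpr ⟨c, rfl⟩) ⟨?_, ?_⟩,
    fun c => rfl⟩
  · exact fun x y hxy => hf (congrArg Subtype.val hxy)
  · rintro ⟨y, hy⟩
    obtain ⟨c, hc⟩ := (hS y).mp hy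
    exact ⟨c, Subtype.ext hc⟩

variable {A B : Type u} [CStarAlgebra A] [CStarAlgebra B] (φ : State A) (ψ : State B)

/-- The class of an element in the GNS space. -/
def State.toGNS : A →ₗ[ℂ] φ.gns.carrier where
  toFun a := φ.rep a φ.gns.vacuum
  map_add' a b := by simp
  map_smul' c a := by simp

theorem State.toGNS_apply (a : A) : φ.toGNS a = φ.rep a φ.gns.vacuum := rfl

theorem State.rep_toGNS (a b : A) : φ.rep a (φ.toGNS b) = φ.toGNS (a * b) := by
  simp [State.toGNS_apply]

theorem State.continuous_toGNS : Continuous φ.toGNS :=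
  (φ.toGNS.mkContinuous ‖φ.gns.vacuum‖ fun a => by
    rw [mul_comm]
    exact (ContinuousLinearMap.le_opNorm _ _).trans (mul_le_mul_of_nonneg_right
      (NonUnitalStarAlgHom.norm_apply_le φ.rep a) (norm_nonneg _))).continuous

/-- The map `a ⊗ b ↦ [a] ⊗ [b]` from the algebraic tensor product to the tensor product of the
GNS spaces. -/
def tensorVec : A ⊗[ℂ] B →ₗ[ℂ] HilbertTensor φ.gns.carrier ψ.gns.carrier :=
  TensorProduct.lift (htmul.compl₁₂ φ.toGNS ψ.toGNS)

theorem tensorVec_tmul (a : A) (b : B) : tensorVec φ ψ (a ⊗ₜ b) = htmul (φ.toGNS a) (ψ.toGNS b) :=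
  TensorProduct.lift.tmul _ _

/-- The GNS classes are dense in each factor; approximating one factor at a time reaches every
elementary tensor. -/
theorem denseRange_tensorVec : DenseRange (tensorVec φ ψ) := by
  set S := (LinearMap.range (tensorVec φ ψ)).topologicalClosure
  have hS : IsClosed (S : Set (HilbertTensor φ.gns.carrier ψ.gns.carrier)) :=
    Submodule.isClosed_topologicalClosure _
  have h1 : ∀ x y, htmul x y ∈ S := fun x y => by
    refine φ.denseRange_rep_vacuum.induction_on
      (p := fun x : φ.gns.carrier => htmul x y ∈ S) x ?_ fun a => ?_
    · have hc : Continuous fun x : φ.gns.carrier => htmul x y :=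
        ((htmul.flip y).mkContinuous ‖y‖ fun x => by
          rw [LinearMap.flip_apply, norm_htmul, mul_comm]).continuous
      exact hS.preimage hc
    · refine ψ.denseRange_rep_vacuum.induction_on
        (p := fun y : ψ.gns.carrier => htmul (φ.rep a φ.gns.vacuum) y ∈ S) y ?_ fun b => ?_
      · exact hS.preimage (htmulL (φ.rep a φ.gns.vacuum)).continuous
      · exact Submodule.le_topologicalClosure _ ⟨a ⊗ₜ b, tensorVec_tmul φ ψ a b⟩
  have h2 : ∀ x, x ∈ S := fun x => by
    refine denseRange_toHilbertTensor.induction_on x hS fun t => ?_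
    induction t using TensorProduct.induction_on with
    | zero => simp
    | add x y hx hy => rw [map_add]; exact S.add_mem hx hy
    | tmul x y => exact h1 x y
  exact fun x => h2 x

/-- The linear functional `f ⊗ g` on the algebraic tensor product. -/
def tensorFunctional (f : A →ₗ[ℂ] ℂ) (g : B →ₗ[ℂ] ℂ) : A ⊗[ℂ] B →ₗ[ℂ] ℂ :=
  TensorProduct.lift ((LinearMap.mul ℂ ℂ).compl₁₂ f g)

theorem tensorFunctional_tmul (f : A →ₗ[ℂ] ℂ) (g : B →ₗ[ℂ] ℂ) (a : A) (b : B) :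
    tensorFunctional f g (a ⊗ₜ b) = f a * g b :=
  TensorProduct.lift.tmul _ _

variable {C : Type w} [CStarAlgebra C] {α : A →⋆ₐ[ℂ] C} {β : B →⋆ₐ[ℂ] C}
  (hcomm : ∀ a b, Commute (α a) (β b))

/-- The multiplication map `a ⊗ b ↦ α a * β b`. -/
def mulMap : A ⊗[ℂ] B →ₐ[ℂ] C :=
  Algebra.TensorProduct.lift α.toAlgHom β.toAlgHom hcomm

theorem mulMap_tmul (a : A) (b : B) : mulMap hcomm (a ⊗ₜ b) = α a * β b :=
  Algebra.TensorProduct.lift_tmul _ _ _ _ _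

/-- Commutation rewrites (α a β b)* (α c β d) as α(a* c) β(b* d), so the inner products factor. `g`
is only a linear functional because the identity also serves to prove its positivity. -/
theorem inner_tensorVec (g : C →ₗ[ℂ] ℂ) (hg : ∀ a b, g (α a * β b) = φ a * ψ b)
    (x y : A ⊗[ℂ] B) :
    ⟪tensorVec φ ψ x, tensorVec φ ψ y⟫_ℂ = g (star (mulMap hcomm x) * mulMap hcomm y) := by
  induction x using TensorProduct.induction_on with
  | zero => simp
  | add x₁ x₂ h₁ h₂ => simp only [map_add, inner_add_left, h₁, h₂, star_add, add_mul]
  | tmul a b =>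
    induction y using TensorProduct.induction_on with
    | zero => simp
    | add y₁ y₂ h₁ h₂ => simp only [map_add, inner_add_right, h₁, h₂, mul_add]
    | tmul c d =>
      rw [tensorVec_tmul, tensorVec_tmul, inner_htmul, State.toGNS_apply, State.toGNS_apply,
        State.toGNS_apply, State.toGNS_apply, State.inner_rep_vacuum, State.inner_rep_vacuum, ← hg,
        mulMap_tmul, mulMap_tmul, star_mul, map_mul α, map_mul β, map_star α, map_star β]
      congr 1
      have h1 : Commute (star (β b)) (star (α a)) := (hcomm a b).star_star.symm
      have h2 : Commute (star (β b)) (α c) := by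
        rw [← map_star]; exact (hcomm c (star b)).symm
      rw [h1.eq, mul_assoc, mul_assoc, ← mul_assoc (star (β b)), h2.eq]
      simp only [mul_assoc]

/-- A product functional which is bounded for the norm of `C` extends to a state of `C`. -/
theorem exists_state_of_norm_le (hd : DenseRange (mulMap hcomm))
    (h : ∀ x, ‖tensorFunctional φ.toLinearMap ψ.toLinearMap x‖ ≤ ‖mulMap hcomm x‖) :
    ∃ τ : State C, ∀ a b, τ (α a * β b) = φ a * ψ b := by
  -- The norm bound makes the product functional descend along the multiplication map, and density
  -- extends it to all of `C`.
  let g : C →L[ℂ] ℂ :=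
    (tensorFunctional φ.toLinearMap ψ.toLinearMap).extendOfNorm (mulMap hcomm).toLinearMap
  have hgq : ∀ a b, g (α a * β b) = φ a * ψ b := fun a b => by
    rw [← mulMap_tmul hcomm, ← tensorFunctional_tmul]
    exact LinearMap.extendOfNorm_eq (f := tensorFunctional φ.toLinearMap ψ.toLinearMap)
      (e := (mulMap hcomm).toLinearMap) hd ⟨1, fun x => by simpa using h x⟩ (a ⊗ₜ b)
  refine ⟨⟨g.toLinearMap, ?_, fun c => ?_⟩, hgq⟩
  · have := hgq 1 1
    rw [map_one, map_one, mul_one, φ.map_one, ψ.map_one, mul_one] at this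
    exact this
  -- On the dense range, `g (c* c)` is the squared norm of a vector of the tensor product.
  · refine hd.induction_on (p := fun c => 0 ≤ g (star c * c)) c ?_ fun x => ?_
    · exact isClosed_Ici.preimage (g.continuous.comp (continuous_star.mul continuous_id))
    · have := inner_tensorVec φ ψ hcomm g.toLinearMap hgq x x
      rw [ContinuousLinearMap.coe_coe] at this
      rw [← this, inner_self_eq_norm_sq_to_K]
      norm_cast
      positivity

/-- A product state of `C` gives a representation of `C` on the tensor product of the GNS spaces. -/
theorem exists_rep_of_state (hd : DenseRange (mulMap hcomm)) (τ : State C)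
    (hτ : ∀ a b, τ (α a * β b) = φ a * ψ b) :
    ∃ Φ : C →⋆ₐ[ℂ] (HilbertTensor φ.gns.carrier ψ.gns.carrier →L[ℂ]
        HilbertTensor φ.gns.carrier ψ.gns.carrier),
      (∀ a b, Φ (α a * β b) = hmap (φ.rep a) (ψ.rep b)) ∧
        (τ.IsFaithful → Function.Injective Φ) := by
  have hds : DenseRange (τ.toGNS ∘ₗ (mulMap hcomm).toLinearMap) :=
    τ.denseRange_rep_vacuum.comp hd τ.continuous_toGNS
  -- Both families of vectors have the inner products prescribed by `τ`, so the GNS space of `τ` is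
  -- the tensor product of the two GNS spaces.
  obtain ⟨U, hU⟩ := exists_linearIsometryEquiv_of_denseRange hds (denseRange_tensorVec φ ψ)
    (fun x => by
      rw [@norm_eq_sqrt_re_inner ℂ, @norm_eq_sqrt_re_inner ℂ,
        inner_tensorVec φ ψ hcomm τ.toLinearMap hτ]
      change _ = √(RCLike.re ⟪τ.rep _ τ.gns.vacuum, τ.rep _ τ.gns.vacuum⟫_ℂ)
      rw [State.inner_rep_vacuum]
      rfl)
  refine ⟨conjRep τ.rep U, fun a b => ?_, fun hf => ?_⟩
  · refine ContinuousLinearMap.ext fun x => ?_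
    refine (denseRange_tensorVec φ ψ).induction_on x (isClosed_eq
      (ContinuousLinearMap.continuous _) (ContinuousLinearMap.continuous _)) fun y => ?_
    change U (τ.rep _ (U.symm _)) = _
    induction y using TensorProduct.induction_on with
    | zero => simp
    | add y₁ y₂ h₁ h₂ => simp only [map_add, h₁, h₂]
    | tmul c d =>
      rw [← hU, LinearIsometryEquiv.symm_apply_apply, hU, tensorVec_tmul, hmap_htmul,
        State.rep_toGNS, State.rep_toGNS, ← tensorVec_tmul, ← hU, LinearMap.comp_apply,
        LinearMap.comp_apply, State.rep_toGNS, AlgHom.toLinearMap_apply, AlgHom.toLinearMap_apply,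
        ← mulMap_tmul hcomm, ← map_mul, Algebra.TensorProduct.tmul_mul_tmul]
  · exact U.conjStarAlgEquiv.injective.comp hf.rep_injective

end TensorRep

/-! ### Recognition of the minimal tensor product. -/

section MinTensor

/-- A uniformly bounded family of *-homomorphisms as a *-homomorphism to the bounded families. -/
def lpStarAlgHom {ι C : Type*} {D : ι → Type*} [NormedRing C] [StarRing C]
    [Algebra ℂ C] [∀ i, NormedRing (D i)] [∀ i, NormedAlgebra ℂ (D i)] [∀ i, StarRing (D i)]
    [∀ i, NormedStarGroup (D i)] [∀ i, StarModule ℂ (D i)] [∀ i, NormOneClass (D i)]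
    (Φ : ∀ i, C →⋆ₐ[ℂ] D i) (h : ∀ i c, ‖Φ i c‖ ≤ ‖c‖) : C →⋆ₐ[ℂ] lp D ∞ where
  toFun c := ⟨fun i => Φ i c, memℓp_infty ⟨‖c‖, by
    rintro _ ⟨i, rfl⟩
    exact h i c⟩⟩
  map_one' := lp.ext (funext fun i => map_one (Φ i))
  map_mul' x y := lp.ext (funext fun i => map_mul (Φ i) x y)
  map_zero' := lp.ext (funext fun i => map_zero (Φ i))
  map_add' x y := lp.ext (funext fun i => map_add (Φ i) x y)
  commutes' r := lp.ext (funext fun i => AlgHomClass.commutes (Φ i) r)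
  map_star' x := lp.ext (funext fun i => map_star (Φ i) x)

/-- All coordinates are contractive, so a single isometric one fixes the supremum. -/
theorem isometry_lpStarAlgHom {ι C : Type*} {D : ι → Type*} [NormedRing C] [StarRing C]
    [Algebra ℂ C] [∀ i, NormedRing (D i)] [∀ i, NormedAlgebra ℂ (D i)] [∀ i, StarRing (D i)]
    [∀ i, NormedStarGroup (D i)] [∀ i, StarModule ℂ (D i)] [∀ i, NormOneClass (D i)]
    (Φ : ∀ i, C →⋆ₐ[ℂ] D i) (h : ∀ i c, ‖Φ i c‖ ≤ ‖c‖) {i : ι} (hi : ∀ c, ‖Φ i c‖ = ‖c‖) :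
    Isometry (lpStarAlgHom Φ h) := by
  refine AddMonoidHomClass.isometry_of_norm _ fun c => le_antisymm ?_ ?_
  · exact lp.norm_le_of_forall_le (norm_nonneg c) fun p => h p c
  · rw [← hi c]
    exact lp.norm_apply_le_norm ENNReal.top_ne_zero (lpStarAlgHom Φ h c) i

/-- An isometric *-homomorphism of a complete algebra is an isomorphism onto the closed
*-subalgebra generated by `s` if it maps a dense set into, and covers, a generating set. -/
theorem exists_starAlgEquiv_topologicalClosure_adjoin {X C D : Type*} [NormedRing C] [StarRing C]
    [CompleteSpace C] [NormedAlgebra ℂ C] [NormedRing D] [StarRing D] [NormedAlgebra ℂ D]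
    [ContinuousStar D] [StarModule ℂ D] (Ψ : C →⋆ₐ[ℂ] D) (hΨ : Isometry Ψ) {q : X → C}
    (hq : DenseRange q) {s : Set D} (hqs : ∀ x, Ψ (q x) ∈ StarAlgebra.adjoin ℂ s)
    (hs : ∀ y ∈ s, ∃ c, Ψ c = y) :
    ∃ e : C ≃⋆ₐ[ℂ] (StarAlgebra.adjoin ℂ s).topologicalClosure, ∀ c, (e c : D) = Ψ c := by
  refine exists_starAlgEquiv_of_range Ψ hΨ.injective _ fun y => ⟨fun hy => ?_, ?_⟩
  · have hle : (StarAlgebra.adjoin ℂ s).topologicalClosure ≤ Ψ.range :=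
      StarSubalgebra.topologicalClosure_minimal (StarAlgebra.adjoin_le fun y hy => hs y hy)
        hΨ.isClosedEmbedding.isClosed_range
    exact hle hy
  · rintro ⟨c, rfl⟩
    exact hq.induction_on (p := fun c => Ψ c ∈ (StarAlgebra.adjoin ℂ s).topologicalClosure) c
      ((StarSubalgebra.isClosed_topologicalClosure _).preimage hΨ.continuous)
      fun x => StarSubalgebra.le_topologicalClosure _ (hqs x)

variable {A B : Type u} [CStarAlgebra A] [CStarAlgebra B]
variable {C : Type w} [CStarAlgebra C] {α : A →⋆ₐ[ℂ] C} {β : B →⋆ₐ[ℂ] C}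
  (hcomm : ∀ a b, Commute (α a) (β b))

set_option maxHeartbeats 1000000 in
/-- A C*-algebra generated by commuting copies of `A` and `B` is the minimal tensor product if all
product functionals are bounded and some product state is faithful. -/
theorem exists_starAlgEquiv_minTensor (hd : DenseRange (mulMap hcomm))
    (h : ∀ (φ : State A) (ψ : State B) x,
      ‖tensorFunctional φ.toLinearMap ψ.toLinearMap x‖ ≤ ‖mulMap hcomm x‖)
    {φ₀ : State A} {ψ₀ : State B} {τ₀ : State C} (hτ₀ : ∀ a b, τ₀ (α a * β b) = φ₀ a * ψ₀ b)
    (hf : τ₀.IsFaithful) :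
    ∃ e : C ≃⋆ₐ[ℂ] MinTensor A B, ∀ a b, e (α a * β b) = MinTensor.tmul a b := by
  have key : ∀ p : State A × State B, ∃ Φ : C →⋆ₐ[ℂ] GNSTensorOp A B p,
      (∀ a b, Φ (α a * β b) = hmap (p.1.rep a) (p.2.rep b)) ∧
        (p = (φ₀, ψ₀) → Function.Injective Φ) := fun p => by
    -- At the distinguished pair `τ₀` itself is used. This gives a faithful coordinate without
    -- identifying `τ₀` with the state obtained by extension.
    by_cases hp : p = (φ₀, ψ₀)
    · subst hp
      obtain ⟨Φ, h1, h2⟩ := exists_rep_of_state φ₀ ψ₀ hcomm hd τ₀ hτ₀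
      exact ⟨Φ, h1, fun _ => h2 hf⟩
    · obtain ⟨τ, hτ⟩ := exists_state_of_norm_le p.1 p.2 hcomm hd (h p.1 p.2)
      obtain ⟨Φ, h1, -⟩ := exists_rep_of_state p.1 p.2 hcomm hd τ hτ
      exact ⟨Φ, h1, fun h' => absurd h' hp⟩
  choose Φ hΦ hinj using key
  have hle : ∀ p c, ‖Φ p c‖ ≤ ‖c‖ := fun p c => NonUnitalStarAlgHom.norm_apply_le (Φ p) c
  have hΨ : ∀ a b, lpStarAlgHom Φ hle (α a * β b) = tensorFamily a b := fun a b =>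
    lp.ext (funext fun p => hΦ p a b)
  have hiso := isometry_lpStarAlgHom Φ hle (i := (φ₀, ψ₀))
    fun c => NonUnitalStarAlgHom.norm_map (Φ (φ₀, ψ₀)) (hinj _ rfl) c
  obtain ⟨e, he⟩ := exists_starAlgEquiv_topologicalClosure_adjoin _ hiso hd
    (s := {x | ∃ a b, x = tensorFamily (A := A) (B := B) a b}) (fun x => by
      induction x using TensorProduct.induction_on with
      | zero => rw [map_zero, map_zero]; exact zero_mem _
      | add x y hx hy => rw [map_add, map_add]; exact add_mem hx hy
      | tmul a b =>
        rw [mulMap_tmul, hΨ]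
        exact StarAlgebra.subset_adjoin ℂ _ ⟨a, b, rfl⟩)
    (fun y ⟨a, b, hy⟩ => ⟨α a * β b, (hΨ a b).trans hy.symm⟩)
  exact ⟨e, fun a b => Subtype.ext ((he _).trans (hΨ a b))⟩

end MinTensor

/-! ### The left and right actions on vectors of the free product. -/

section FreeProductVectors

theorem inner_hmap_adjoint {E F : Type*} [NormedAddCommGroup E] [InnerProductSpace ℂ E]
    [CompleteSpace E] [NormedAddCommGroup F] [InnerProductSpace ℂ F] [CompleteSpace F]
    (S : E →L[ℂ] E) (T : F →L[ℂ] F) (x y : HilbertTensor E F) :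
    ⟪hmap S T x, y⟫_ℂ = ⟪x, hmap S.adjoint T.adjoint y⟫_ℂ := by
  refine denseRange_toHilbertTensor.induction_on₂ (isClosed_eq (by fun_prop) (by fun_prop))
    (fun a b => ?_) x y
  rw [hmap_toHilbertTensor, hmap_toHilbertTensor, LinearIsometry.inner_map_map,
    LinearIsometry.inner_map_map]
  induction a using TensorProduct.induction_on with
  | zero => simp
  | add a₁ a₂ h₁ h₂ => simp only [map_add, inner_add_left, h₁, h₂]
  | tmul a y =>
    induction b using TensorProduct.induction_on with
    | zero => simp
    | add b₁ b₂ h₁ h₂ => simp only [map_add, inner_add_right, h₁, h₂]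
    | tmul b z =>
      rw [TensorProduct.mapL_tmul, TensorProduct.mapL_tmul, TensorProduct.inner_tmul,
        TensorProduct.inner_tmul, ContinuousLinearMap.adjoint_inner_right,
        ContinuousLinearMap.adjoint_inner_right]

theorem adjoint_hmap {E F : Type*} [NormedAddCommGroup E] [InnerProductSpace ℂ E]
    [CompleteSpace E] [NormedAddCommGroup F] [InnerProductSpace ℂ F] [CompleteSpace F]
    (S : E →L[ℂ] E) (T : F →L[ℂ] F) : (hmap S T).adjoint = hmap S.adjoint T.adjoint :=
  ((ContinuousLinearMap.eq_adjoint_iff _ _).mpr fun x y => by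
    rw [← inner_conj_symm, ← inner_hmap_adjoint, inner_conj_symm]).symm

theorem adjoint_apply_map {E F : Type*} [NormedAddCommGroup E] [InnerProductSpace ℂ E]
    [CompleteSpace E] [NormedAddCommGroup F] [InnerProductSpace ℂ F] [CompleteSpace F]
    (V : E →ₗᵢ[ℂ] F) (x : E) : V.toContinuousLinearMap.adjoint (V x) = x :=
  ext_inner_right ℂ fun y => by
    rw [ContinuousLinearMap.adjoint_inner_left]
    exact V.inner_map_map x y

variable {I : Type v} (P : I → PointedHilbert.{u})

/-- Only V*V = 1 enters, so surjectivity of the concatenation map is not needed. -/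
theorem leftRep_leftConcat (i : I) (T : (P i).carrier →L[ℂ] (P i).carrier) (h : (P i).carrier)
    (x : FreeProductL P i) : leftRep P i T (leftConcat P i h x) = leftConcat P i (T h) x := by
  have hV : ∀ h, leftConcat P i h x = leftUnitary P i (htmul h x) := fun h =>
    (hlift_htmul _ (inner_leftConcat P i) h x).symm
  rw [hV, hV]
  change leftUnitary P i (hmap T _ ((leftUnitary P i).toContinuousLinearMap.adjoint _)) = _
  rw [adjoint_apply_map, hmap_htmul]
  rfl

theorem rightRep_rightConcat (i : I) (T : (P i).carrier →L[ℂ] (P i).carrier) (h : (P i).carrier)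
    (x : FreeProductR P i) : rightRep P i T (rightConcat P i h x) = rightConcat P i (T h) x := by
  have hV : ∀ h, rightConcat P i h x = rightUnitary P i (htmul x h) := fun h =>
    (hlift_htmul (rightConcat P i).flip _ x h).symm
  rw [hV, hV]
  change rightUnitary P i (hmap _ T ((rightUnitary P i).toContinuousLinearMap.adjoint _)) = _
  rw [adjoint_apply_map, hmap_htmul]
  rfl

theorem adjoint_leftRep (i : I) (T : (P i).carrier →L[ℂ] (P i).carrier) :
    (leftRep P i T).adjoint = leftRep P i T.adjoint := by
  rw [leftRep, leftRep, ContinuousLinearMap.adjoint_comp, ContinuousLinearMap.adjoint_comp,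
    ContinuousLinearMap.adjoint_adjoint, adjoint_hmap, ContinuousLinearMap.comp_assoc]
  congr 3
  exact ContinuousLinearMap.adjoint_id

theorem adjoint_rightRep (i : I) (T : (P i).carrier →L[ℂ] (P i).carrier) :
    (rightRep P i T).adjoint = rightRep P i T.adjoint := by
  rw [rightRep, rightRep, ContinuousLinearMap.adjoint_comp, ContinuousLinearMap.adjoint_comp,
    ContinuousLinearMap.adjoint_adjoint, adjoint_hmap, ContinuousLinearMap.comp_assoc]
  congr 3
  exact ContinuousLinearMap.adjoint_id

section Single

variable {α β : Type*} {K : β → Type*} [∀ b, NormedAddCommGroup (K b)]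
  [∀ b, InnerProductSpace ℂ (K b)]

open Classical in
/-- The isometric inclusion of a summand in a Hilbert sum. -/
def singleLp (b : β) : K b →ₗᵢ[ℂ] lp K 2 where
  toFun k := lp.single 2 b k
  map_add' x y := lp.single_add 2 b x y
  map_smul' c x := lp.single_smul 2 b c x
  norm_map' x := lp.norm_single (by norm_num) b x

theorem inner_singleLp (b : β) (k k' : K b) : ⟪singleLp b k, singleLp b k'⟫_ℂ = ⟪k, k'⟫_ℂ :=
  LinearIsometry.inner_map_map _ _ _

/-- Removes the dependence on the decidability instance: the one used for `freeVacuum` need not be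
the one in `singleLp`. -/
theorem singleLp_eq_single [h : DecidableEq β] (b : β) (k : K b) :
    singleLp b k = lp.single 2 b k := by
  obtain rfl : h = fun a b => Classical.propDecidable (a = b) := Subsingleton.elim _ _
  rfl

open Classical in
theorem singleLp_apply_self (b : β) (k : K b) : (singleLp b k : lp K 2) b = k :=
  lp.single_apply_self 2 b k

open Classical in
theorem singleLp_apply_ne (b : β) (k : K b) {b' : β} (h : b' ≠ b) :
    (singleLp b k : lp K 2) b' = 0 :=
  lp.single_apply_ne 2 b k h

theorem pushLp_singleLp (e : α ↪ β) (a : α) (k : K (e a)) :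
    pushLp e (singleLp (K := fun a => K (e a)) a k) = singleLp (e a) k := by
  refine lp.ext (funext fun b => ?_)
  rw [pushLp_apply]
  by_cases hb : b ∈ Set.range e
  · obtain ⟨a', rfl⟩ := hb
    rw [push_apply]
    by_cases h : a' = a
    · subst h
      rw [singleLp_apply_self, singleLp_apply_self]
    · exact (singleLp_apply_ne (K := fun a => K (e a)) a k h).trans
        (singleLp_apply_ne (e a) k fun h' => h (e.injective h')).symm
  · rw [push_of_notMem e _ hb, singleLp_apply_ne]
    rintro rfl
    exact hb ⟨a, rfl⟩

theorem concat_singleLp (Q : PointedHilbert.{u}) (e₀ e₁ : α ↪ β)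
    (c : ∀ a, Q.reduced →ₗ[ℂ] K (e₀ a) →ₗ[ℂ] K (e₁ a))
    (hc : ∀ a x x' y y', ⟪c a x y, c a x' y'⟫_ℂ = ⟪x, x'⟫_ℂ * ⟪y, y'⟫_ℂ) (h : Q.carrier) (a : α)
    (k : K (e₀ a)) :
    concat Q e₀ e₁ c hc h (singleLp (K := fun a => K (e₀ a)) a k) =
      ⟪Q.vacuum, h⟫_ℂ • singleLp (e₀ a) k + singleLp (e₁ a) (c a (Q.proj h) k) := by
  rw [concat_apply, pushLp_singleLp]
  congr 1
  rw [← pushLp_singleLp e₁]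
  congr 1
  refine lp.ext (funext fun b => ?_)
  change c b (Q.proj h) (singleLp (K := fun a => K (e₀ a)) a k b) = _
  by_cases hb : b = a
  · subst hb
    rw [singleLp_apply_self, singleLp_apply_self]
  · exact (congrArg _ (singleLp_apply_ne (K := fun a => K (e₀ a)) a k hb)).trans ((map_zero _).trans
      (singleLp_apply_ne (K := fun a => K (e₁ a)) a _ hb).symm)

end Single

/-- A vector of one summand of the free product. -/
def word (w : AltWord I) : WordSpace P w.1 →ₗᵢ[ℂ] FreeProduct P :=
  singleLp (K := fun w : AltWord I => WordSpace P w.1) w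

/-- The basis vector of the space of the empty word. -/
def emptyVec : WordSpace P ([] : List I) :=
  (EuclideanSpace.single PUnit.unit (1 : ℂ) : EuclideanSpace ℂ PUnit.{u + 1})

theorem norm_emptyVec : ‖emptyVec P‖ = 1 := by
  have h : ‖(EuclideanSpace.single PUnit.unit (1 : ℂ) : EuclideanSpace ℂ PUnit.{u + 1})‖ = 1 := by
    simp
  exact h

theorem inner_emptyVec : ⟪emptyVec P, emptyVec P⟫_ℂ = 1 := by
  rw [inner_self_eq_norm_sq_to_K, norm_emptyVec]
  simp

/-- The empty word. -/
abbrev emptyWord : AltWord I := ⟨[], List.isChain_nil⟩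

/-- The word `[i]`. -/
abbrev letter (i : I) : AltWord I := ⟨[i], List.isChain_singleton i⟩

/-- The word `[i, j]`. -/
abbrev twoLetters {i j : I} (h : i ≠ j) : AltWord I := ⟨[i, j], List.isChain_pair.mpr h⟩

theorem head?_emptyWord_ne (i : I) : (emptyWord : AltWord I).1.head? ≠ some i :=
  fun h => nomatch h

theorem getLast?_emptyWord_ne (i : I) : (emptyWord : AltWord I).1.getLast? ≠ some i :=
  fun h => nomatch h

theorem head?_cons_ne {i j : I} (h : i ≠ j) (w : List I) : (j :: w).head? ≠ some i :=
  fun h' => h (Option.some.inj h').symm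

theorem getLast?_letter_ne {i j : I} (h : i ≠ j) : (letter j).1.getLast? ≠ some i :=
  fun h' => h (Option.some.inj h').symm

theorem getLast?_twoLetters_ne {i j : I} (h : i ≠ j) : (twoLetters h).1.getLast? ≠ some i :=
  fun h' => h (Option.some.inj h').symm

/-- A vector of `H°_i` as a vector of the summand of the word `[i]`. -/
def letterVec (i : I) (k : (P i).reduced) : WordSpace P (letter i).1 :=
  consTensor P i [] k (emptyVec P)

theorem inner_letterVec (i : I) (k k' : (P i).reduced) :
    ⟪letterVec P i k, letterVec P i k'⟫_ℂ = ⟪k, k'⟫_ℂ := by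
  rw [letterVec, letterVec, inner_consTensor, inner_emptyVec, mul_one]

open Classical in
theorem freeVacuum_eq_word : freeVacuum P = word P emptyWord (emptyVec P) :=
  (singleLp_eq_single (K := fun w : AltWord I => WordSpace P w.1) emptyWord (emptyVec P)).symm

/-- The vectors of `H(l, i)` in the summand of a word. -/
def wordL (i : I) (w : AltWordL i) (k : WordSpace P w.1.1) : FreeProductL P i :=
  singleLp (K := fun w : AltWordL i => WordSpace P w.1.1) w k

/-- The vectors of `H(r, i)` in the summand of a word. -/
def wordR (i : I) (w : AltWordR i) (k : WordSpace P w.1.1) : FreeProductR P i :=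
  singleLp (K := fun w : AltWordR i => WordSpace P w.1.1) w k

theorem leftConcat_wordL (i : I) (h : (P i).carrier) (w : AltWordL i) (k : WordSpace P w.1.1) :
    leftConcat P i h (wordL P i w k) = ⟪(P i).vacuum, h⟫_ℂ • word P w.1 k +
        word P (consWord i w) (consTensor P i w.1.1 ((P i).proj h) k) :=
  concat_singleLp (K := fun w : AltWord I => WordSpace P w.1) (P i) (Function.Embedding.subtype _)
    (consWord i) (fun w => consTensor P i w.1.1) (fun w => inner_consTensor P i w.1.1) h w k

theorem rightConcat_wordR (i : I) (h : (P i).carrier) (w : AltWordR i) (k : WordSpace P w.1.1) :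
    rightConcat P i h (wordR P i w k) = ⟪(P i).vacuum, h⟫_ℂ • word P w.1 k +
        word P (snocWord i w) (snocTensor P i w.1.1 ((P i).proj h) k) :=
  concat_singleLp (K := fun w : AltWord I => WordSpace P w.1) (P i) (Function.Embedding.subtype _)
    (snocWord i) (fun w => ContinuousLinearMap.coeLM ℂ ∘ₗ snocTensor P i w.1.1)
    (fun w => inner_snocTensor P i w.1.1) h w k

theorem inner_wordL (i : I) (w : AltWordL i) (k k' : WordSpace P w.1.1) :
    ⟪wordL P i w k, wordL P i w k'⟫_ℂ = ⟪k, k'⟫_ℂ :=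
  inner_singleLp _ _ _

theorem inner_wordR (i : I) (w : AltWordR i) (k k' : WordSpace P w.1.1) :
    ⟪wordR P i w k, wordR P i w k'⟫_ℂ = ⟪k, k'⟫_ℂ :=
  inner_singleLp _ _ _

/-- The inclusion of `H(l, i)` in the free product. -/
def pushL (i : I) : FreeProductL P i →ₗ[ℂ] FreeProduct P :=
  pushLp (K := fun w : AltWord I => WordSpace P w.1) (Function.Embedding.subtype _)

theorem inner_pushL (i : I) (x y : FreeProductL P i) : ⟪pushL P i x, pushL P i y⟫_ℂ = ⟪x, y⟫_ℂ :=
  inner_pushLp (K := fun w : AltWord I => WordSpace P w.1) (Function.Embedding.subtype _) x y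

theorem pushL_wordL (i : I) (w : AltWordL i) (k : WordSpace P w.1.1) :
    pushL P i (wordL P i w k) = word P w.1 k :=
  pushLp_singleLp (K := fun w : AltWord I => WordSpace P w.1) (Function.Embedding.subtype _) w k

/-- The inclusion of `H_i` in the free product. -/
def incl (i : I) : (P i).carrier →ₗᵢ[ℂ] FreeProduct P :=
  ((leftConcat P i).flip (wordL P i ⟨emptyWord, head?_emptyWord_ne i⟩ (emptyVec P))).isometryOfInner
    fun h h' => by
      rw [LinearMap.flip_apply, LinearMap.flip_apply, inner_leftConcat, inner_wordL,
        inner_emptyVec, mul_one]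

theorem incl_eq (i : I) (h : (P i).carrier) : incl P i h =
    ⟪(P i).vacuum, h⟫_ℂ • freeVacuum P + word P (letter i) (letterVec P i ((P i).proj h)) :=
  (leftConcat_wordL P i h ⟨emptyWord, head?_emptyWord_ne i⟩ (emptyVec P)).trans
    (by rw [freeVacuum_eq_word]; rfl)

/-- On the empty word, adding a letter in front or at the end gives the same vector. Hence the left
and right actions of an operator agree on the copy of H_i. -/
theorem incl_eq_rightConcat (i : I) (h : (P i).carrier) : incl P i h =
    rightConcat P i h (wordR P i ⟨emptyWord, getLast?_emptyWord_ne i⟩ (emptyVec P)) := by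
  rw [rightConcat_wordR, incl_eq, freeVacuum_eq_word]
  rfl

theorem leftRep_incl (i : I) (T : (P i).carrier →L[ℂ] (P i).carrier) (h : (P i).carrier) :
    leftRep P i T (incl P i h) = incl P i (T h) :=
  leftRep_leftConcat P i T h _

theorem rightRep_incl (i : I) (T : (P i).carrier →L[ℂ] (P i).carrier) (h : (P i).carrier) :
    rightRep P i T (incl P i h) = incl P i (T h) := by
  rw [incl_eq_rightConcat, rightRep_rightConcat, incl_eq_rightConcat]

theorem PointedHilbert.proj_vacuum (Q : PointedHilbert.{u}) :
    Q.proj Q.vacuum = 0 :=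
  Submodule.orthogonalProjectionOnto_apply_of_mem_orthogonal
    (by
      rw [Submodule.mem_orthogonal]
      intro y hy
      rw [Submodule.mem_orthogonal_singleton_iff_inner_left] at hy
      exact hy)

theorem PointedHilbert.inner_vacuum (Q : PointedHilbert.{u}) :
    ⟪Q.vacuum, Q.vacuum⟫_ℂ = 1 := by
  rw [inner_self_eq_norm_sq_to_K, Q.norm_vacuum]
  simp

theorem letterVec_zero (i : I) : letterVec P i 0 = 0 := by
  rw [letterVec, map_zero, LinearMap.zero_apply]

theorem incl_vacuum (i : I) : incl P i (P i).vacuum = freeVacuum P := by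
  rw [incl_eq, PointedHilbert.proj_vacuum, PointedHilbert.inner_vacuum, letterVec_zero, map_zero,
    one_smul, add_zero]

/-! ### Vectors η ⊗ k ⊗ ζ with a letter j between two letters i. -/

variable {i j : I} (hij : i ≠ j)

/-- The vector `k ⊗ ζ` of `H(l, i)` for `k` in `H°_j` and `ζ` in `H_i`. -/
def innerL (k : (P j).reduced) (ζ : (P i).carrier) : FreeProductL P i :=
  ⟪(P i).vacuum, ζ⟫_ℂ • wordL P i ⟨letter j, head?_cons_ne hij _⟩ (letterVec P j k) +
    wordL P i ⟨twoLetters hij.symm, head?_cons_ne hij _⟩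
      (snocTensor P i [j] ((P i).proj ζ) (letterVec P j k))

/-- The vector `η ⊗ k` of `H(r, i)` for `k` in `H°_j` and `η` in `H_i`. -/
def innerR (η : (P i).carrier) (k : (P j).reduced) : FreeProductR P i :=
  ⟪(P i).vacuum, η⟫_ℂ • wordR P i ⟨letter j, getLast?_letter_ne hij⟩ (letterVec P j k) +
    wordR P i ⟨twoLetters hij, getLast?_twoLetters_ne hij⟩
      (consTensor P i [j] ((P i).proj η) (letterVec P j k))

/-- The vector `η ⊗ k ⊗ ζ` for `η` and `ζ` in `H_i` and `k` in `H°_j`. -/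
def sandwich (η : (P i).carrier) (k : (P j).reduced) (ζ : (P i).carrier) :
    FreeProduct P :=
  leftConcat P i η (innerL P hij k ζ)

/-- Associativity η ⊗ (k ⊗ ζ) = (η ⊗ k) ⊗ ζ, including the cases where a vacuum component is
absorbed. It lets the right action reach ζ. -/
theorem sandwich_eq_rightConcat (η : (P i).carrier) (k : (P j).reduced) (ζ : (P i).carrier) :
    sandwich P hij η k ζ = rightConcat P i ζ (innerR P hij η k) := by
  -- The recursion defining `snocTensor` leaves the first tensor factor alone.
  have h : snocTensor P i [i, j] ((P i).proj ζ)
        (consTensor P i [j] ((P i).proj η) (letterVec P j k)) =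
      consTensor P i [j, i] ((P i).proj η)
        (snocTensor P i [j] ((P i).proj ζ) (letterVec P j k)) :=
    hmap_htmul _ _ _ _
  rw [sandwich, innerL, innerR, map_add, map_add, map_smul, map_smul, leftConcat_wordL,
    leftConcat_wordL, rightConcat_wordR, rightConcat_wordR]
  -- Both words unfold to [i, j, i], so the two sides lie in the same summand definitionally.
  have h' : word P (snocWord i ⟨twoLetters hij, getLast?_twoLetters_ne hij⟩)
      (snocTensor P i [i, j] ((P i).proj ζ)
        (consTensor P i [j] ((P i).proj η) (letterVec P j k))) =
      word P (consWord i ⟨twoLetters hij.symm, head?_cons_ne hij _⟩)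
        (consTensor P i [j, i] ((P i).proj η)
        (snocTensor P i [j] ((P i).proj ζ) (letterVec P j k))) := congrArg _ h
  erw [h']
  simp only [smul_add, smul_smul, mul_comm ⟪(P i).vacuum, η⟫_ℂ]
  erw [add_assoc, add_assoc]
  congr 1
  exact add_left_comm _ _ _

theorem leftRep_sandwich (T : (P i).carrier →L[ℂ] (P i).carrier) (η : (P i).carrier)
    (k : (P j).reduced) (ζ : (P i).carrier) :
    leftRep P i T (sandwich P hij η k ζ) = sandwich P hij (T η) k ζ :=
  leftRep_leftConcat P i T η _

theorem rightRep_sandwich (T : (P i).carrier →L[ℂ] (P i).carrier) (η : (P i).carrier)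
    (k : (P j).reduced) (ζ : (P i).carrier) :
    rightRep P i T (sandwich P hij η k ζ) = sandwich P hij η k (T ζ) := by
  rw [sandwich_eq_rightConcat, rightRep_rightConcat, sandwich_eq_rightConcat]

theorem sandwich_vacuum (k : (P j).reduced) :
    sandwich P hij (P i).vacuum k (P i).vacuum = word P (letter j) (letterVec P j k) := by
  have h : ∀ w x, leftConcat P i (P i).vacuum (wordL P i w x) = word P w.1 x := fun w x => by
    rw [leftConcat_wordL, PointedHilbert.proj_vacuum, PointedHilbert.inner_vacuum, one_smul,
      map_zero, LinearMap.zero_apply]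
    erw [map_zero]
    exact add_zero _
  rw [sandwich, innerL, PointedHilbert.proj_vacuum, PointedHilbert.inner_vacuum, one_smul, map_add,
    h, h, map_zero, zero_apply, map_zero, add_zero]

/-- The left concatenation splits off η. The remaining vector k ⊗ ζ, viewed in the whole product, is
a right concatenation, which splits off ζ. -/
theorem inner_sandwich (η η' : (P i).carrier) (k k' : (P j).reduced) (ζ ζ' : (P i).carrier) :
    ⟪sandwich P hij η k ζ, sandwich P hij η' k' ζ'⟫_ℂ = ⟪η, η'⟫_ℂ * ⟪k, k'⟫_ℂ * ⟪ζ, ζ'⟫_ℂ := by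
  have h : ∀ (k : (P j).reduced) (ζ : (P i).carrier), pushL P i (innerL P hij k ζ) =
      rightConcat P i ζ (wordR P i ⟨letter j, getLast?_letter_ne hij⟩ (letterVec P j k)) :=
    fun k ζ => by
      rw [rightConcat_wordR, innerL, map_add, map_smul, pushL_wordL, pushL_wordL]
      rfl
  rw [sandwich, sandwich, inner_leftConcat, ← inner_pushL, h, h, inner_rightConcat, inner_wordR,
    inner_letterVec]
  ring

end FreeProductVectors

/-! ### Lifting a representation through a separating vector. -/

section Dilation

variable {C H K : Type*} [CStarAlgebra C]
  [NormedAddCommGroup H] [InnerProductSpace ℂ H] [CompleteSpace H]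
  [NormedAddCommGroup K] [InnerProductSpace ℂ K] [CompleteSpace K]

/-- The operators which are reduced by the range of the isometry `u`. -/
def reducing (u : K →ₗᵢ[ℂ] H) : StarSubalgebra ℂ (H →L[ℂ] H) :=
  StarSubalgebra.centralizer ℂ
    {u.toContinuousLinearMap ∘L u.toContinuousLinearMap.adjoint}

theorem isClosed_reducing (u : K →ₗᵢ[ℂ] H) : IsClosed (reducing u : Set (H →L[ℂ] H)) :=
  Set.isClosed_centralizer _

theorem apply_of_mem_reducing {u : K →ₗᵢ[ℂ] H} {T : H →L[ℂ] H} (hT : T ∈ reducing u) (h : K) :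
    u (u.toContinuousLinearMap.adjoint (T (u h))) = T (u h) := by
  have h1 := ((StarSubalgebra.mem_centralizer_iff ℂ).mp hT _ rfl).1
  have h2 := DFunLike.congr_fun h1 (u h)
  change u (u.toContinuousLinearMap.adjoint (T (u h))) =
    T (u (u.toContinuousLinearMap.adjoint (u h))) at h2
  rwa [adjoint_apply_map] at h2

/-- The condition on the adjoint dualizes to u* T = R u*; with T u = u R this makes `T` commute with
the projection u u*. -/
theorem mem_reducing {u : K →ₗᵢ[ℂ] H} {T : H →L[ℂ] H} {R : K →L[ℂ] K}
    (h1 : ∀ h, T (u h) = u (R h)) (h2 : ∀ h, T.adjoint (u h) = u (R.adjoint h)) :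
    T ∈ reducing u := by
  have h3 : ∀ x, u.toContinuousLinearMap.adjoint (T x) =
      R (u.toContinuousLinearMap.adjoint x) := fun x => ext_inner_right ℂ fun y => by
    rw [ContinuousLinearMap.adjoint_inner_left, ← ContinuousLinearMap.adjoint_inner_right]
    change ⟪x, T.adjoint (u y)⟫_ℂ = _
    rw [h2, ← ContinuousLinearMap.adjoint_inner_right R, ContinuousLinearMap.adjoint_inner_left]
    rfl
  have h4 : (u.toContinuousLinearMap ∘L u.toContinuousLinearMap.adjoint) * T =
      T * (u.toContinuousLinearMap ∘L u.toContinuousLinearMap.adjoint) :=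
    ContinuousLinearMap.ext fun x => by
      change u (u.toContinuousLinearMap.adjoint (T x)) =
        T (u (u.toContinuousLinearMap.adjoint x))
      rw [h3, h1]
  refine (StarSubalgebra.mem_centralizer_iff ℂ).mpr ?_
  rintro _ rfl
  refine ⟨h4, ?_⟩
  have h5 : star (u.toContinuousLinearMap ∘L u.toContinuousLinearMap.adjoint) =
      u.toContinuousLinearMap ∘L u.toContinuousLinearMap.adjoint := by
    rw [ContinuousLinearMap.star_eq_adjoint, ContinuousLinearMap.adjoint_comp,
      ContinuousLinearMap.adjoint_adjoint]
  rw [h5, h4]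

/-- The restriction to the range of `u` of the operators in a *-subalgebra reduced by it. -/
def compression (u : K →ₗᵢ[ℂ] H) (E : StarSubalgebra ℂ (H →L[ℂ] H))
    (hE : E ≤ reducing u) : E →⋆ₐ[ℂ] (K →L[ℂ] K) where
  toFun T := u.toContinuousLinearMap.adjoint ∘L T.1 ∘L u.toContinuousLinearMap
  map_one' := ContinuousLinearMap.ext fun h => adjoint_apply_map u h
  map_mul' S T := ContinuousLinearMap.ext fun h => by
    change u.toContinuousLinearMap.adjoint (S.1 (T.1 (u h))) =
      u.toContinuousLinearMap.adjoint (S.1 (u (u.toContinuousLinearMap.adjoint (T.1 (u h)))))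
    rw [apply_of_mem_reducing (hE T.2)]
  map_zero' := ContinuousLinearMap.ext fun h => map_zero u.toContinuousLinearMap.adjoint
  map_add' S T := ContinuousLinearMap.ext fun h => map_add u.toContinuousLinearMap.adjoint _ _
  commutes' r := ContinuousLinearMap.ext fun h => by
    change u.toContinuousLinearMap.adjoint (r • u h) = r • h
    rw [map_smul, adjoint_apply_map]
  map_star' T := by
    change u.toContinuousLinearMap.adjoint ∘L T.1.adjoint ∘L u.toContinuousLinearMap =
      (u.toContinuousLinearMap.adjoint ∘L T.1 ∘L u.toContinuousLinearMap).adjoint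
    rw [ContinuousLinearMap.adjoint_comp, ContinuousLinearMap.adjoint_comp,
      ContinuousLinearMap.adjoint_adjoint, ContinuousLinearMap.comp_assoc]

theorem map_compression_apply (u : K →ₗᵢ[ℂ] H) (E : StarSubalgebra ℂ (H →L[ℂ] H))
    (hE : E ≤ reducing u) (T : E) (h : K) : u (compression u E hE T h) = T.1 (u h) :=
  apply_of_mem_reducing (hE T.2) h

/-- If a closed *-subalgebra `D` of `B(H)` has a separating vector in the range of `u`, and contains
dilations of the operators `π s` for `s` in a generating set, then it contains a dilation of the
representation `π`. -/
theorem exists_dilation (π : C →⋆ₐ[ℂ] (K →L[ℂ] K)) (u : K →ₗᵢ[ℂ] H)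
    (D : StarSubalgebra ℂ (H →L[ℂ] H)) (hD : IsClosed (D : Set (H →L[ℂ] H))) (ξ : K)
    (hξ : ∀ T ∈ D, T (u ξ) = 0 → T = 0) (s : Set C)
    (hs : (StarAlgebra.adjoin ℂ s).topologicalClosure = ⊤)
    (hg : ∀ c ∈ s, ∃ T ∈ D, (∀ h, T (u h) = u (π c h)) ∧ ∀ h, T.adjoint (u h) = u ((π c).adjoint h)) :
    ∃ θ : C →⋆ₐ[ℂ] (H →L[ℂ] H), (∀ c, θ c ∈ D) ∧ ∀ c h, θ c (u h) = u (π c h) := by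
  set E : StarSubalgebra ℂ (H →L[ℂ] H) := D ⊓ reducing u
  have hE : IsClosed (E : Set (H →L[ℂ] H)) := hD.inter (isClosed_reducing u)
  have hEr : E ≤ reducing u := inf_le_right
  let _ : CStarAlgebra E := StarSubalgebra.cstarAlgebra E (h_closed := hE)
  set κ := compression u E hEr
  -- An operator with zero compression kills the separating vector `u ξ`.
  have hinj : Function.Injective κ := (injective_iff_map_eq_zero κ).mpr fun T hT =>
    Subtype.ext (hξ T.1 T.2.1 (by rw [← map_compression_apply u E hEr T ξ, hT]; simp))
  have hiso : Isometry κ := NonUnitalStarAlgHom.isometry κ hinj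
  have hcl : IsClosed (κ.range : Set (K →L[ℂ] K)) := hiso.isClosedEmbedding.isClosed_range
  -- The elements represented inside the closed range of `κ` form a closed *-subalgebra containing
  -- the generators.
  have hex : ∀ c, ∃ T : E, κ T = π c := fun c => by
    have hle : (⊤ : StarSubalgebra ℂ C) ≤ κ.range.comap π := by
      rw [← hs]
      refine StarSubalgebra.topologicalClosure_minimal (StarAlgebra.adjoin_le fun c hc => ?_) ?_
      · obtain ⟨T, hTD, h1, h2⟩ := hg c hc
        refine ⟨⟨T, hTD, mem_reducing h1 h2⟩, ContinuousLinearMap.ext fun h => u.injective ?_⟩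
        exact (map_compression_apply u E hEr _ h).trans (h1 h)
      · exact hcl.preimage (AddMonoidHomClass.continuous_of_bound π 1 fun c => by
          rw [one_mul]; exact NonUnitalStarAlgHom.norm_apply_le π c)
    exact hle (StarSubalgebra.mem_top (x := c))
  -- `t` is κ⁻¹ ∘ π, so each algebraic law follows from injectivity of `κ`.
  choose t ht using hex
  refine ⟨⟨⟨⟨⟨⟨fun c => (t c).1, ?_⟩, ?_⟩, ?_, ?_⟩, ?_⟩, ?_⟩, fun c => (t c).2.1, fun c h => ?_⟩
  · exact congrArg Subtype.val (hinj ((ht 1).trans ((map_one π).trans (map_one κ).symm)))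
  · exact fun x y => congrArg Subtype.val (a₂ := t x * t y)
      (hinj (by rw [ht, map_mul, map_mul, ht, ht]))
  · exact congrArg Subtype.val (a₂ := (0 : E)) (hinj (by rw [ht, map_zero, map_zero]))
  · exact fun x y => congrArg Subtype.val (a₂ := t x + t y)
      (hinj (by rw [ht, map_add, map_add, ht, ht]))
  · exact fun r => congrArg Subtype.val (a₂ := algebraMap ℂ E r)
      (hinj (by rw [ht, AlgHomClass.commutes π, AlgHomClass.commutes κ]))
  · exact fun x => congrArg Subtype.val (a₂ := star (t x))
      (hinj (by rw [ht, map_star, map_star, ht]))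
  · change (t c).1 (u h) = _
    rw [← map_compression_apply u E hEr, ht]

end Dilation

/-! ### From products of vector functionals to products of states. -/

section Slices

variable {A B : Type u} [CStarAlgebra A] [CStarAlgebra B]
  {K : Type v} [NormedAddCommGroup K] [InnerProductSpace ℂ K] [CompleteSpace K]

/-- The vector functional `a ↦ ⟪η, π a η⟫`. -/
def vectorFunctional (π : A →⋆ₐ[ℂ] (K →L[ℂ] K)) (η : K) : A →ₗ[ℂ] ℂ where
  toFun a := ⟪η, π a η⟫_ℂ
  map_add' a b := by rw [map_add, add_apply, inner_add_right]
  map_smul' c a := by rw [map_smul, smul_apply, inner_smul_right]; rfl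

theorem vectorFunctional_apply (π : A →⋆ₐ[ℂ] (K →L[ℂ] K)) (η : K) (a : A) :
    vectorFunctional π η a = ⟪η, π a η⟫_ℂ := rfl

/-- The vector state of a unit vector. -/
def vectorState (π : A →⋆ₐ[ℂ] (K →L[ℂ] K)) (η : K) (hη : ‖η‖ = 1) : State A where
  toLinearMap := vectorFunctional π η
  map_one' := by
    change ⟪η, π 1 η⟫_ℂ = 1
    rw [map_one, one_apply_eq_self, inner_self_eq_norm_sq_to_K, hη]
    simp
  nonneg' a := by
    change 0 ≤ ⟪η, π (star a * a) η⟫_ℂ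
    rw [map_mul, map_star, ContinuousLinearMap.star_eq_adjoint]
    change 0 ≤ ⟪η, (π a).adjoint (π a η)⟫_ℂ
    rw [ContinuousLinearMap.adjoint_inner_right, inner_self_eq_norm_sq_to_K]
    norm_cast
    positivity

/-- The slice map `a ⊗ b ↦ g b • a`. -/
def sliceRight (g : B →ₗ[ℂ] ℂ) : A ⊗[ℂ] B →ₗ[ℂ] A :=
  (TensorProduct.rid ℂ A).toLinearMap ∘ₗ g.lTensor A

/-- The slice map `a ⊗ b ↦ f a • b`. -/
def sliceLeft (f : A →ₗ[ℂ] ℂ) : A ⊗[ℂ] B →ₗ[ℂ] B :=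
  (TensorProduct.lid ℂ B).toLinearMap ∘ₗ f.rTensor B

theorem apply_sliceRight (f : A →ₗ[ℂ] ℂ) (g : B →ₗ[ℂ] ℂ) (x : A ⊗[ℂ] B) :
    f (sliceRight g x) = tensorFunctional f g x := by
  induction x using TensorProduct.induction_on with
  | zero => simp
  | add x y hx hy => rw [map_add, map_add, map_add, hx, hy]
  | tmul a b => simp [sliceRight, tensorFunctional_tmul, mul_comm]

theorem apply_sliceLeft (f : A →ₗ[ℂ] ℂ) (g : B →ₗ[ℂ] ℂ) (x : A ⊗[ℂ] B) :
    g (sliceLeft f x) = tensorFunctional f g x := by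
  induction x using TensorProduct.induction_on with
  | zero => simp
  | add x y hx hy => rw [map_add, map_add, map_add, hx, hy]
  | tmul a b => simp [sliceLeft, tensorFunctional_tmul]

/-- A bound for products of vector functionals of faithful representations is a bound for products
of states. -/
theorem norm_tensorFunctional_le (π : A →⋆ₐ[ℂ] (K →L[ℂ] K)) (hπ : Function.Injective π)
    (ρ : B →⋆ₐ[ℂ] (K →L[ℂ] K)) (hρ : Function.Injective ρ) {x : A ⊗[ℂ] B} {N : ℝ}
    (h : ∀ η ζ, ‖tensorFunctional (vectorFunctional π η) (vectorFunctional ρ ζ) x‖ ≤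
      N * ‖η‖ ^ 2 * ‖ζ‖ ^ 2) (φ : State A) (ψ : State B) :
    ‖tensorFunctional φ.toLinearMap ψ.toLinearMap x‖ ≤ N := by
  rw [← apply_sliceLeft]
  -- The numerical radius bound is applied to one slice at a time: `ψ` is replaced by a vector
  -- functional, then `φ`.
  refine ψ.norm_le_of_forall_inner ρ hρ fun ζ => ?_
  rw [← vectorFunctional_apply, apply_sliceLeft, ← apply_sliceRight]
  refine φ.norm_le_of_forall_inner π hπ fun η => ?_
  rw [← vectorFunctional_apply, apply_sliceRight]
  exact (h η ζ).trans_eq (by ring)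

end Slices

/-! ### Consequences of a separating vacuum. -/

section Faces

variable {A : Type u} [CStarAlgebra A]

theorem PairOfFaces.topologicalClosure_adjoin (F : PairOfFaces A) :
    (StarAlgebra.adjoin ℂ (Set.range F.inl ∪ Set.range F.inr)).topologicalClosure = ⊤ := by
  refine top_unique fun x _ => ?_
  set S := StarAlgebra.adjoin ℂ (Set.range F.inl ∪ Set.range F.inr)
  have hle : F.left ⊔ F.right ≤ S.map F.generated.subtype := by
    refine sup_le (fun a ha => ⟨F.inl ⟨a, ha⟩, ?_, rfl⟩) fun b hb => ⟨F.inr ⟨b, hb⟩, ?_, rfl⟩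
    · exact StarAlgebra.subset_adjoin ℂ _ (Or.inl ⟨_, rfl⟩)
    · exact StarAlgebra.subset_adjoin ℂ _ (Or.inr ⟨_, rfl⟩)
  have h : (x : A) ∈ closure ((↑) '' (S : Set F.generated)) := closure_mono hle x.2
  exact closure_subtype.mpr h

/-- Since the faces commute, the range is closed under the star and hence a *-subalgebra containing
both faces. -/
theorem PairOfFaces.denseRange_mulMap (F : PairOfFaces A)
    (hcomm : ∀ a b, Commute (F.inl a) (F.inr b)) : DenseRange (mulMap hcomm) := by
  let S : StarSubalgebra ℂ F.generated :=
    { (mulMap hcomm).range with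
      star_mem' := by
        rintro _ ⟨x, rfl⟩
        induction x using TensorProduct.induction_on with
        | zero => exact ⟨0, by simp⟩
        | add x y hx hy =>
          obtain ⟨x', hx⟩ := hx
          obtain ⟨y', hy⟩ := hy
          exact ⟨x' + y', by simpa using congrArg₂ (· + ·) hx hy⟩
        | tmul a b =>
          refine ⟨star a ⊗ₜ star b, ?_⟩
          change mulMap hcomm _ = star (mulMap hcomm _)
          rw [mulMap_tmul, mulMap_tmul, star_mul, map_star, map_star, (hcomm a b).star_star.eq] }
  have hle : StarAlgebra.adjoin ℂ (Set.range F.inl ∪ Set.range F.inr) ≤ S := by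
    refine StarAlgebra.adjoin_le ?_
    rintro _ (⟨a, rfl⟩ | ⟨b, rfl⟩)
    · exact ⟨a ⊗ₜ 1, (mulMap_tmul hcomm a 1).trans (by rw [map_one, mul_one])⟩
    · exact ⟨1 ⊗ₜ b, (mulMap_tmul hcomm 1 b).trans (by rw [map_one, one_mul])⟩
  intro x
  have hx : x ∈ (StarAlgebra.adjoin ℂ
      (Set.range F.inl ∪ Set.range F.inr)).topologicalClosure := by
    rw [F.topologicalClosure_adjoin]
    trivial
  exact closure_mono hle hx

variable {I : Type v} {φ : State A} {F : I → PairOfFaces A}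

theorem isClosed_biFreeProduct :
    IsClosed (biFreeProduct φ F :
      Set (FreeProduct (faceHilbert φ F) →L[ℂ] FreeProduct (faceHilbert φ F))) :=
  StarSubalgebra.isClosed_topologicalClosure _

theorem leftRep_mem_biFreeProduct (i : I) (a : (F i).left) :
    leftRep _ i (faceRep φ F i ((F i).inl a)) ∈ biFreeProduct φ F :=
  StarSubalgebra.le_topologicalClosure _ (StarAlgebra.subset_adjoin ℂ _ (Or.inl ⟨i, a, rfl⟩))

theorem rightRep_mem_biFreeProduct (i : I) (b : (F i).right) :
    rightRep _ i (faceRep φ F i ((F i).inr b)) ∈ biFreeProduct φ F :=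
  StarSubalgebra.le_topologicalClosure _ (StarAlgebra.subset_adjoin ℂ _ (Or.inr ⟨i, b, rfl⟩))

theorem eq_zero_of_apply_freeVacuum (hfaithful : (biFreeState φ F).IsFaithful)
    {T : FreeProduct (faceHilbert φ F) →L[ℂ] FreeProduct (faceHilbert φ F)}
    (hT : T ∈ biFreeProduct φ F) (h : T (freeVacuum (faceHilbert φ F)) = 0) : T = 0 := by
  refine congrArg Subtype.val (hfaithful ⟨T, hT⟩ ?_)
  change ⟪freeVacuum (faceHilbert φ F), T.adjoint (T (freeVacuum (faceHilbert φ F)))⟫_ℂ = 0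
  rw [h, map_zero, inner_zero_right]

theorem eq_of_apply_freeVacuum (hfaithful : (biFreeState φ F).IsFaithful)
    {S T : FreeProduct (faceHilbert φ F) →L[ℂ] FreeProduct (faceHilbert φ F)}
    (hS : S ∈ biFreeProduct φ F) (hT : T ∈ biFreeProduct φ F)
    (h : S (freeVacuum (faceHilbert φ F)) = T (freeVacuum (faceHilbert φ F))) : S = T :=
  sub_eq_zero.mp (eq_zero_of_apply_freeVacuum hfaithful (sub_mem hS hT) (sub_eq_zero.mpr h))

/-- If the bi-free product state is faithful, the bi-free product contains copies of the algebras
generated by the pairs of faces. -/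
theorem exists_faceDilation (hfaithful : (biFreeState φ F).IsFaithful) (i : I) :
    ∃ θ : (F i).generated →⋆ₐ[ℂ]
        (FreeProduct (faceHilbert φ F) →L[ℂ] FreeProduct (faceHilbert φ F)),
      (∀ c, θ c ∈ biFreeProduct φ F) ∧
      (∀ c h, θ c (incl (faceHilbert φ F) i h) = incl (faceHilbert φ F) i (faceRep φ F i c h)) ∧
      (∀ a, θ ((F i).inl a) = leftRep _ i (faceRep φ F i ((F i).inl a))) ∧
      ∀ b, θ ((F i).inr b) = rightRep _ i (faceRep φ F i ((F i).inr b)) := by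
  obtain ⟨θ, h1, h2⟩ := exists_dilation (faceRep φ F i) (incl (faceHilbert φ F) i)
    (biFreeProduct φ F) isClosed_biFreeProduct (faceHilbert φ F i).vacuum
    (fun T hT h => eq_zero_of_apply_freeVacuum hfaithful hT (by rwa [incl_vacuum] at h))
    _ (F i).topologicalClosure_adjoin (by
      rintro _ (⟨a, rfl⟩ | ⟨b, rfl⟩)
      · refine ⟨_, leftRep_mem_biFreeProduct i a, fun h => leftRep_incl _ i _ h, fun h => ?_⟩
        rw [adjoint_leftRep, leftRep_incl]
      · refine ⟨_, rightRep_mem_biFreeProduct i b, fun h => rightRep_incl _ i _ h, fun h => ?_⟩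
        rw [adjoint_rightRep, rightRep_incl])
  refine ⟨θ, h1, h2, fun a => ?_, fun b => ?_⟩
  -- Both operators lie in the bi-free product, so agreement at the vacuum suffices.
  · refine eq_of_apply_freeVacuum hfaithful (h1 _) (leftRep_mem_biFreeProduct i a) ?_
    rw [← incl_vacuum _ i, h2, leftRep_incl]
  · refine eq_of_apply_freeVacuum hfaithful (h1 _) (rightRep_mem_biFreeProduct i b) ?_
    rw [← incl_vacuum _ i, h2, rightRep_incl]

theorem faceRep_injective {i : I} (hφ : (faceState φ F i).IsFaithful) :
    Function.Injective (faceRep φ F i) :=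
  hφ.rep_injective

theorem inner_vacuum_faceRep (i : I) (c : (F i).generated) :
    ⟪(faceHilbert φ F i).vacuum, faceRep φ F i c (faceHilbert φ F i).vacuum⟫_ℂ =
      faceState φ F i c := by
  have h := (faceState φ F i).inner_rep_vacuum 1 c
  rw [map_one, star_one, one_mul] at h
  exact h

/-- Centre a non-scalar element by subtracting its expectation. -/
theorem exists_ne_zero_faceState_eq_zero {i : I} (hi : (F i).generated ≠ ⊥) :
    ∃ c : (F i).generated, c ≠ 0 ∧ faceState φ F i c = 0 := by
  obtain ⟨x, hx, hx'⟩ := SetLike.exists_of_lt (bot_lt_iff_ne_bot.mpr hi)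
  refine ⟨⟨x, hx⟩ - faceState φ F i ⟨x, hx⟩ • 1, fun h => hx' ?_, ?_⟩
  · have h' : x = faceState φ F i ⟨x, hx⟩ • (1 : A) := congrArg Subtype.val (sub_eq_zero.mp h)
    rw [h']
    exact SMulMemClass.smul_mem _ (one_mem _)
  · rw [map_sub, map_smul, State.map_one, smul_eq_mul, mul_one, sub_self]

/-- An operator of the bi-free product which vanishes on `H°_j` is zero. -/
theorem eq_zero_of_apply_letter (hfaithful : (biFreeState φ F).IsFaithful) {j : I}
    (hj : (F j).generated ≠ ⊥) (hφ : (faceState φ F j).IsFaithful)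
    {T : FreeProduct (faceHilbert φ F) →L[ℂ] FreeProduct (faceHilbert φ F)}
    (hT : T ∈ biFreeProduct φ F)
    (h : ∀ k, T (word _ (letter j) (letterVec (faceHilbert φ F) j k)) = 0) : T = 0 := by
  obtain ⟨θ, hθD, hθ, -⟩ := exists_faceDilation hfaithful j
  obtain ⟨c, hc, hc0⟩ := exists_ne_zero_faceState_eq_zero (φ := φ) hj
  -- π_j(c)ξ_j is φ_j(c)ξ_j plus a vector of H°_j, and `T` kills the latter.
  have hvac : ∀ c, T (θ c (freeVacuum _)) = faceState φ F j c • T (freeVacuum _) := fun c => by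
    rw [← incl_vacuum _ j, hθ, incl_eq, map_add, h, add_zero, map_smul, inner_vacuum_faceRep,
      incl_vacuum]
  have hTS : T * θ c = 0 := by
    refine eq_zero_of_apply_freeVacuum hfaithful (mul_mem hT (hθD c)) ?_
    change T (θ c _) = 0
    rw [hvac, hc0, zero_smul]
  refine eq_zero_of_apply_freeVacuum hfaithful hT ?_
  -- As Tθ(c) = 0, also Tθ(cc*) = 0, so φ_j(cc*) Tξ = 0. Faithfulness of φ_j makes the scalar
  -- nonzero, whence Tξ = 0.
  have h1 := hvac (c * star c)
  have h2 : T (θ (c * star c) (freeVacuum _)) = (T * θ c) (θ (star c) (freeVacuum _)) := by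
    rw [map_mul]
    rfl
  rw [h2, hTS, zero_apply] at h1
  refine (smul_eq_zero.mp h1.symm).resolve_left fun h3 => hc ?_
  have h4 := hφ (star c) (by rwa [star_star])
  exact star_eq_zero.mp h4

end Faces

/-! ### Commutation, norm bounds and the faithful product state. -/

section Main

variable {A : Type u} [CStarAlgebra A] {I : Type v} {φ : State A} {F : I → PairOfFaces A}

/-- The GNS representation restricted to the left face. -/
def leftFaceRep (φ : State A) (F : I → PairOfFaces A) (i : I) :
    (F i).left →⋆ₐ[ℂ] ((faceHilbert φ F i).carrier →L[ℂ] (faceHilbert φ F i).carrier) :=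
  (faceRep φ F i).comp (F i).inl

/-- The GNS representation restricted to the right face. -/
def rightFaceRep (φ : State A) (F : I → PairOfFaces A) (i : I) :
    (F i).right →⋆ₐ[ℂ] ((faceHilbert φ F i).carrier →L[ℂ] (faceHilbert φ F i).carrier) :=
  (faceRep φ F i).comp (F i).inr

variable {i j : I}
  {θ : (F i).generated →⋆ₐ[ℂ] (FreeProduct (faceHilbert φ F) →L[ℂ] FreeProduct (faceHilbert φ F))}

/-- The commutator kills every k in H°_j, seen as ξ_i ⊗ k ⊗ ξ_i, because the two faces act on
different legs. -/
theorem commute_inl_inr (hij : i ≠ j)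
    (hl : ∀ a, θ ((F i).inl a) = leftRep _ i (faceRep φ F i ((F i).inl a)))
    (hr : ∀ b, θ ((F i).inr b) = rightRep _ i (faceRep φ F i ((F i).inr b)))
    (hfaithful : (biFreeState φ F).IsFaithful) (hj : (F j).generated ≠ ⊥)
    (hφ : ∀ i, (faceState φ F i).IsFaithful) (hθD : ∀ c, θ c ∈ biFreeProduct φ F)
    (hθ : Function.Injective θ) (a : (F i).left) (b : (F i).right) :
    Commute ((F i).inl a) ((F i).inr b) := by
  refine hθ (sub_eq_zero.mp ?_)
  refine eq_zero_of_apply_letter hfaithful hj (hφ j) (sub_mem (hθD _) (hθD _)) fun k => ?_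
  rw [← sandwich_vacuum _ hij, map_mul, map_mul, hl, hr, sub_apply]
  change leftRep _ i _ (rightRep _ i _ _) - rightRep _ i _ (leftRep _ i _ _) = 0
  rw [rightRep_sandwich, leftRep_sandwich, leftRep_sandwich, rightRep_sandwich, sub_self]

theorem inner_sandwich_mulMap (hij : i ≠ j)
    (hl : ∀ a, θ ((F i).inl a) = leftRep _ i (faceRep φ F i ((F i).inl a)))
    (hr : ∀ b, θ ((F i).inr b) = rightRep _ i (faceRep φ F i ((F i).inr b)))
    (hcomm : ∀ a b, Commute ((F i).inl a) ((F i).inr b))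
    (η : (faceHilbert φ F i).carrier) (k : (faceHilbert φ F j).reduced)
    (ζ : (faceHilbert φ F i).carrier) (x : (F i).left ⊗[ℂ] (F i).right) :
    ⟪sandwich _ hij η k ζ, θ (mulMap hcomm x) (sandwich _ hij η k ζ)⟫_ℂ =
      ‖k‖ ^ 2 * tensorFunctional (vectorFunctional (leftFaceRep φ F i) η)
        (vectorFunctional (rightFaceRep φ F i) ζ) x := by
  induction x using TensorProduct.induction_on with
  | zero => simp
  | add x y hx hy =>
    rw [map_add, map_add, map_add, add_apply, inner_add_right, hx, hy, mul_add]
  | tmul a b =>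
    rw [mulMap_tmul, map_mul, hl, hr, tensorFunctional_tmul, vectorFunctional_apply,
      vectorFunctional_apply]
    change ⟪_, leftRep _ i _ (rightRep _ i _ _)⟫_ℂ = _
    rw [rightRep_sandwich, leftRep_sandwich, inner_sandwich, inner_self_eq_norm_sq_to_K]
    change _ * (‖k‖ : ℂ) ^ 2 * _ = _
    rw [mul_comm _ ((‖k‖ : ℂ) ^ 2), mul_assoc]
    rfl

theorem norm_sandwich (hij : i ≠ j) (η : (faceHilbert φ F i).carrier) (k : (faceHilbert φ F j).reduced)
    (ζ : (faceHilbert φ F i).carrier) :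
    ‖sandwich (faceHilbert φ F) hij η k ζ‖ = ‖η‖ * ‖k‖ * ‖ζ‖ := by
  have h := inner_sandwich (faceHilbert φ F) hij η η k k ζ ζ
  simp only [inner_self_eq_norm_sq_to_K] at h
  rw [← mul_pow, ← mul_pow] at h
  norm_cast at h
  exact (pow_left_inj₀ (norm_nonneg _) (by positivity) two_ne_zero).mp h

/-- A nonzero centred element sends ξ_j to a nonzero vector of H°_j, by faithfulness. -/
theorem exists_norm_eq_one (hj : (F j).generated ≠ ⊥) (hφ : (faceState φ F j).IsFaithful) :
    ∃ k : (faceHilbert φ F j).reduced, ‖k‖ = 1 := by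
  obtain ⟨c, hc, hc0⟩ := exists_ne_zero_faceState_eq_zero (φ := φ) hj
  have : Nontrivial (faceHilbert φ F j).reduced := by
    refine ⟨⟨⟨faceRep φ F j c (faceHilbert φ F j).vacuum,
      Submodule.mem_orthogonal_singleton_iff_inner_right.mpr
        ((inner_vacuum_faceRep j c).trans hc0)⟩, 0, fun h => hc (hφ c ?_)⟩⟩
    have h' : (faceState φ F j).rep c (faceState φ F j).gns.vacuum = 0 := congrArg Subtype.val h
    rw [← (faceState φ F j).inner_rep_vacuum, h', inner_zero_left]
  exact exists_norm_eq _ zero_le_one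

theorem leftFaceRep_injective (hφ : (faceState φ F i).IsFaithful) :
    Function.Injective (leftFaceRep φ F i) :=
  (faceRep_injective hφ).comp fun _ _ h =>
    Subtype.ext (congrArg (fun x : (F i).generated => (x : A)) h)

theorem rightFaceRep_injective (hφ : (faceState φ F i).IsFaithful) :
    Function.Injective (rightFaceRep φ F i) :=
  (faceRep_injective hφ).comp fun _ _ h =>
    Subtype.ext (congrArg (fun x : (F i).generated => (x : A)) h)

/-- Product functionals are bounded on the algebra generated by a pair of faces. -/
theorem norm_tensorFunctional_le_norm_mulMap (hij : i ≠ j)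
    (hl : ∀ a, θ ((F i).inl a) = leftRep _ i (faceRep φ F i ((F i).inl a)))
    (hr : ∀ b, θ ((F i).inr b) = rightRep _ i (faceRep φ F i ((F i).inr b)))
    (hcomm : ∀ a b, Commute ((F i).inl a) ((F i).inr b))
    (hφ : (faceState φ F i).IsFaithful) {k : (faceHilbert φ F j).reduced} (hk : ‖k‖ = 1)
    (ψ₁ : State (F i).left) (ψ₂ : State (F i).right) (x : (F i).left ⊗[ℂ] (F i).right) :
    ‖tensorFunctional ψ₁.toLinearMap ψ₂.toLinearMap x‖ ≤ ‖mulMap hcomm x‖ := by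
  refine norm_tensorFunctional_le _ (leftFaceRep_injective hφ) _ (rightFaceRep_injective hφ)
    (fun η ζ => ?_) ψ₁ ψ₂
  have h := inner_sandwich_mulMap hij hl hr hcomm η k ζ x
  rw [hk, Complex.ofReal_one, one_pow, one_mul] at h
  rw [← h]
  have h1 : ‖θ (mulMap hcomm x)‖ ≤ ‖mulMap hcomm x‖ := NonUnitalStarAlgHom.norm_apply_le θ _
  have h2 : ‖sandwich (faceHilbert φ F) hij η k ζ‖ = ‖η‖ * ‖ζ‖ := by
    rw [norm_sandwich, hk, mul_one]
  calc _ ≤ ‖sandwich (faceHilbert φ F) hij η k ζ‖ *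
        (‖θ (mulMap hcomm x)‖ * ‖sandwich (faceHilbert φ F) hij η k ζ‖) :=
        (norm_inner_le_norm _ _).trans
          (mul_le_mul_of_nonneg_left (ContinuousLinearMap.le_opNorm _ _) (norm_nonneg _))
    _ ≤ ‖sandwich (faceHilbert φ F) hij η k ζ‖ *
        (‖mulMap hcomm x‖ * ‖sandwich (faceHilbert φ F) hij η k ζ‖) := by gcongr
    _ = _ := by rw [h2]; ring

/-- Both sides are continuous in `y` and agree on the dense range of `mulMap`. Thus vanishing for
one unit vector `k₀` spreads to every `k`. -/
theorem vectorFunctional_sandwich (hij : i ≠ j)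
    (hl : ∀ a, θ ((F i).inl a) = leftRep _ i (faceRep φ F i ((F i).inl a)))
    (hr : ∀ b, θ ((F i).inr b) = rightRep _ i (faceRep φ F i ((F i).inr b)))
    (hcomm : ∀ a b, Commute ((F i).inl a) ((F i).inr b))
    {k₀ : (faceHilbert φ F j).reduced} (hk₀ : ‖k₀‖ = 1) (η ζ : (faceHilbert φ F i).carrier)
    (k : (faceHilbert φ F j).reduced) (y : (F i).generated) :
    vectorFunctional θ (sandwich _ hij η k ζ) y =
      ‖k‖ ^ 2 * vectorFunctional θ (sandwich _ hij η k₀ ζ) y := by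
  have hc : ∀ w : FreeProduct (faceHilbert φ F), Continuous (vectorFunctional θ w) := fun w =>
    continuous_const.inner ((ContinuousLinearMap.apply ℂ _ w).continuous.comp
      (AddMonoidHomClass.continuous_of_bound θ 1 fun c => by
        rw [one_mul]; exact NonUnitalStarAlgHom.norm_apply_le θ c))
  refine congrFun (((F i).denseRange_mulMap hcomm).equalizer (hc _)
    (continuous_const.mul (hc _)) (funext fun x => ?_)) y
  have h := inner_sandwich_mulMap hij hl hr hcomm η k₀ ζ x
  rw [hk₀, Complex.ofReal_one, one_pow, one_mul] at h
  exact (inner_sandwich_mulMap hij hl hr hcomm η k ζ x).trans (congrArg _ h.symm)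

/-- The squared norm of the vector is the functional at c* c, hence proportional to its value at
`k₀`. -/
theorem apply_sandwich_eq_zero (hij : i ≠ j)
    (hl : ∀ a, θ ((F i).inl a) = leftRep _ i (faceRep φ F i ((F i).inl a)))
    (hr : ∀ b, θ ((F i).inr b) = rightRep _ i (faceRep φ F i ((F i).inr b)))
    (hcomm : ∀ a b, Commute ((F i).inl a) ((F i).inr b))
    {k₀ : (faceHilbert φ F j).reduced} (hk₀ : ‖k₀‖ = 1) {η ζ : (faceHilbert φ F i).carrier}
    {c : (F i).generated} (hc : vectorFunctional θ (sandwich _ hij η k₀ ζ) (star c * c) = 0)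
    (k : (faceHilbert φ F j).reduced) : θ c (sandwich _ hij η k ζ) = 0 := by
  have h := vectorFunctional_sandwich hij hl hr hcomm hk₀ η ζ k (star c * c)
  rw [hc, mul_zero, vectorFunctional_apply, map_mul, map_star,
    ContinuousLinearMap.star_eq_adjoint] at h
  change ⟪_, (θ c).adjoint (θ c _)⟫_ℂ = 0 at h
  rwa [ContinuousLinearMap.adjoint_inner_right, inner_self_eq_zero] at h

theorem vectorFunctional_sandwich_vacuum (hij : i ≠ j)
    (hl : ∀ a, θ ((F i).inl a) = leftRep _ i (faceRep φ F i ((F i).inl a)))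
    (hr : ∀ b, θ ((F i).inr b) = rightRep _ i (faceRep φ F i ((F i).inr b)))
    (hcomm : ∀ a b, Commute ((F i).inl a) ((F i).inr b))
    {k : (faceHilbert φ F j).reduced} (hk : ‖k‖ = 1) (a : (F i).left) (b : (F i).right) :
    vectorFunctional θ (sandwich _ hij (faceHilbert φ F i).vacuum k (faceHilbert φ F i).vacuum)
      ((F i).inl a * (F i).inr b) =
        φ.restrict (F i).left a * φ.restrict (F i).right b := by
  have h := inner_sandwich_mulMap hij hl hr hcomm (faceHilbert φ F i).vacuum k
    (faceHilbert φ F i).vacuum (a ⊗ₜ b)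
  rw [hk, Complex.ofReal_one, one_pow, one_mul, tensorFunctional_tmul, mulMap_tmul] at h
  exact h.trans (congrArg₂ (· * ·) (inner_vacuum_faceRep i _) (inner_vacuum_faceRep i _))

/-- On the copy of H_i, `θ` restricts to the faithful GNS representation. -/
theorem injective_of_apply_incl (hφ : (faceState φ F i).IsFaithful)
    (hθ : ∀ c h, θ c (incl (faceHilbert φ F) i h) =
      incl (faceHilbert φ F) i (faceRep φ F i c h)) : Function.Injective θ :=
  (injective_iff_map_eq_zero θ).mpr fun c hc => faceRep_injective hφ (by
    refine (ContinuousLinearMap.ext fun h => (incl (faceHilbert φ F) i).injective ?_).trans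
      (map_zero _).symm
    rw [← hθ, hc, zero_apply, zero_apply, map_zero])

/-- If the bi-free product state is faithful, the algebra generated by a pair of faces has a
faithful state which is the product of the restrictions of `φ` to the faces. -/
theorem exists_isFaithful_state (hij : i ≠ j)
    (hl : ∀ a, θ ((F i).inl a) = leftRep _ i (faceRep φ F i ((F i).inl a)))
    (hr : ∀ b, θ ((F i).inr b) = rightRep _ i (faceRep φ F i ((F i).inr b)))
    (hcomm : ∀ a b, Commute ((F i).inl a) ((F i).inr b))
    (hfaithful : (biFreeState φ F).IsFaithful) (hj : (F j).generated ≠ ⊥)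
    (hφ : (faceState φ F j).IsFaithful) (hθD : ∀ c, θ c ∈ biFreeProduct φ F)
    (hθinj : Function.Injective θ) {k : (faceHilbert φ F j).reduced} (hk : ‖k‖ = 1) :
    ∃ τ : State (F i).generated, τ.IsFaithful ∧ ∀ a b, τ ((F i).inl a * (F i).inr b) =
      φ.restrict (F i).left a * φ.restrict (F i).right b := by
  have hκ : ‖sandwich (faceHilbert φ F) hij (faceHilbert φ F i).vacuum k
      (faceHilbert φ F i).vacuum‖ = 1 := by
    rw [norm_sandwich, (faceHilbert φ F i).norm_vacuum, hk, mul_one, mul_one]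
  refine ⟨vectorState θ _ hκ, fun c hc => hθinj ?_,
    vectorFunctional_sandwich_vacuum hij hl hr hcomm hk⟩
  -- If the functional at one unit vector vanishes at c* c, then θ(c) vanishes on all of H°_j.
  refine (eq_zero_of_apply_letter hfaithful hj hφ (hθD c) fun k' => ?_).trans (map_zero θ).symm
  rw [← sandwich_vacuum _ hij]
  exact apply_sandwich_eq_zero hij hl hr hcomm hk hc k'

end Main

end BiFree

end

open BiFree in
theorem mainTheorem1 {A : Type*} [CStarAlgebra A] (φ : BiFree.State A)
    {I : Type*} (F : I → BiFree.PairOfFaces A) (hF : BiFree.IsNontrivialFamily F)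
    (hφ : ∀ i, (BiFree.faceState φ F i).IsFaithful)
    (hfaithful : (BiFree.biFreeState φ F).IsFaithful) (i : I) :
    (∀ a ∈ (F i).left, ∀ b ∈ (F i).right, a * b = b * a) ∧
      ∃ e : (F i).generated ≃⋆ₐ[ℂ] BiFree.MinTensor (F i).left (F i).right,
        ∀ (a : (F i).left) (b : (F i).right),
          e ((F i).inl a * (F i).inr b) = BiFree.MinTensor.tmul a b := by
  have := hF.1
  -- The second index supplies the letter that separates the two legs in H_i.
  refine (exists_ne i).elim fun j hji => ?_
  refine (exists_faceDilation hfaithful i).elim fun θ h => ?_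
  have hθinj := injective_of_apply_incl (hφ i) h.2.1
  have hcomm := commute_inl_inr hji.symm h.2.2.1 h.2.2.2 hfaithful (hF.2 j) hφ h.1 hθinj
  refine ⟨fun a ha b hb => congrArg Subtype.val (hcomm ⟨a, ha⟩ ⟨b, hb⟩).eq, ?_⟩
  refine (exists_norm_eq_one (hF.2 j) (hφ j)).elim fun k hk => ?_
  refine (exists_isFaithful_state hji.symm h.2.2.1 h.2.2.2 hcomm hfaithful (hF.2 j) (hφ j) h.1
    hθinj hk).elim fun τ hτ => ?_
  exact exists_starAlgEquiv_minTensor hcomm ((F i).denseRange_mulMap hcomm)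
    (norm_tensorFunctional_le_norm_mulMap hji.symm h.2.2.1 h.2.2.2 hcomm (hφ i) hk) hτ.2 hτ.1
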